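/- Fix a vertex set $[N]$. A graph $G=([N],E)$ has no loops and may be directed or undirected; $E$ is a set of ordered pairs (symmetric if $G$ is undirected). For $U,V\subseteq[N]$ let $E_G(U,V)=\{(u,v)\in E: u\in U, v\in V\}$, $\rho_G(U,V)=\frac{|E_G(U,V)|}{|U||V|}$ and $\rho_G=\rho_G([N],[N])$. The graph is \emph{$(\eta,\gamma)$-upper-uniform} if $\rho_G(U,V)\le\gamma\rho_G$ for all disjoint $U,V$ with $\min\{|U|,|V|\}\ge\eta N$, and $|E_G(U,V)|\le\gamma\eta\rho_G N^2$ for all $U,V$ with $\min\{|U|,|V|\}<\eta N$. An \emph{object} is a probability distribution $B$ on $[N]\times[N]$; the \emph{support-access object} of a graph with $E\neq\emptyset$ is the uniform distribution on $E$. A \emph{distinguisher} $D$ is given by sets $U_D,V_D\subseteq[N]$ and accepts $(u,v)$ iff $u\in U_D$ and $v\in V_D$. A \emph{model} is a distribution $M$ over objects; it is \emph{$\varepsilon$-indistinguishable} from $B^*$ w.r.t. a class $\mathcal D$ if $\bigl|\Pr_{e\sim B^*}[D(e)\text{ accepts}]-\mathbb E_{B\sim M}\Pr_{e\sim B}[D(e)\text{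 accepts}]\bigr|\le\varepsilon$ for all $D\in\mathcal D$. A (seeded, randomized) algorithm $T$ \emph{implements} $M$ if for each seed $r$ the output of $T(r)$ is distributed according to some object $B_r$, and $B_r\sim M$ for a uniform seed $r$. For a predictor $p:[N]^2\to[0,1]$, $p\not\equiv0$, write $(u,v)\sim p$ for the distribution that gives $(u,v)$ probability $p(u,v)/\sum_{u',v'}p(u',v')$. For a class $\mathcal B$ of objects, an \emph{$(\varepsilon,\varepsilon',\delta)$-auditor} on $\mathcal B$ for a collection $\mathcal C$ of pairs of vertex sets is a randomized algorithm $\Lambda$ with sample access to an object $B^*\in\mathcal B$ and query access to a predictor $p$ which outputs (Boolean circuits for) sets $U',V'\subseteq[N]$ such that, if some $(U,V)\in\mathcal C$ satisfies $\bigl|\Pr_{(u,v)\sim B^*}[u\in U,v\in V]-\Pr_{(u,v)\sim p}[u\in U,v\in V]\bigr|\ge\varepsilon$, then with probability at least $1-\delta$ the same expression for $(U',V')$ is at least $\varepsilon'$. An \emph{$(\varepsilon,\delta)$-learner} for $\mathcal B$ w.r.t. $\mathcal D$ is an algorithm that, given sample access to any $B^*\in\mathcal B$, outputs an implementation of a model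 which with probability at least $1-\delta$ is $\varepsilon$-indistinguishable from $B^*$ w.r.t. $\mathcal D$. \textbf{Theorem.} For all $\gamma,\varepsilon,\varepsilon',\delta',\delta''>0$ with $\delta'<1$ there are $\eta\in(0,1]$, a constant $C$ and an algorithm $L$, which uses an auditor as a subroutine, such that the following holds for every $N$. Let $\mathcal B$ be a collection of support-access objects of $(\eta,\gamma)$-upper-uniform graphs on $[N]$, let $\mathcal D$ be a collection of distinguishers, and let $\Lambda$ be an $(\varepsilon,\varepsilon',\delta')$-auditor on $\mathcal B$ for $\{(U_D,V_D):D\in\mathcal D\}$. Then $L$ with subroutine $\Lambda$ is an $(\varepsilon,\delta'')$-learner for $\mathcal B$ w.r.t. $\mathcal D$. Moreover, if $\Lambda$ runs in time at most $W_1$ and always outputs circuits of size at most $W_2$, then $L$ runs in time at most $C(1+\log N)(1+W_1)(1+W_2)$, and the implementations it outputs have expected running time at most $C(1+\log N)(1+W_2)$; in particular $L$ runs in time $\mathrm{polylog}(N)$ if $W_1,W_2$ are $\mathrm{polylog}(N)$. -/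

import Mathlib

open Filter Topology
open scoped ENNReal

noncomputable section

namespace SparseGraph

/-! ### Objects, graphs, distinguishers, models -/

/-- The probability of an event, as a real number. -/
def prob {α : Type} (μ : PMF α) (s : Set α) : ℝ := (μ.toOuterMeasure s).toReal

/-- An object `B : {⊥} → Δ([N] × [N])`: there is only one query, so an object is a
distribution over answers. -/
abbrev Object (N : ℕ) : Type := PMF (Fin N × Fin N)

open Classical in
/-- The set `E_G(U, V)` of the edges `(u, v)` with `u ∈ U`, `v ∈ V`. -/
def edgesBetween {N : ℕ} (G : Digraph (Fin N)) (U V : Finset (Fin N)) :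
    Finset (Fin N × Fin N) :=
  (U ×ˢ V).filter fun e => G.Adj e.1 e.2

/-- The edge density `ρ_G(U, V)`. -/
def density {N : ℕ} (G : Digraph (Fin N)) (U V : Finset (Fin N)) : ℝ :=
  ((edgesBetween G U V).card : ℝ) / ((U.card : ℝ) * (V.card : ℝ))

/-- `(η, γ)`-upper uniform graphs. -/
def UpperUniform {N : ℕ} (η γ : ℝ) (G : Digraph (Fin N)) : Prop :=
  (∀ U V : Finset (Fin N), Disjoint U V → η * N ≤ min (U.card : ℝ) (V.card : ℝ) →
    density G U V ≤ γ * density G Finset.univ Finset.univ) ∧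
  (∀ U V : Finset (Fin N), min (U.card : ℝ) (V.card : ℝ) < η * N →
    ((edgesBetween G U V).card : ℝ) ≤
      γ * η * density G Finset.univ Finset.univ * (N : ℝ) ^ 2)

/-- `B` is the support-access object induced by `G`: `G` has an edge, and `B` is the uniform
distribution over the edges of `G`. -/
def IsSupportAccess {N : ℕ} (G : Digraph (Fin N)) (B : Object N) : Prop :=
  ∃ h : (edgesBetween G Finset.univ Finset.univ).Nonempty,
    B = PMF.uniformOfFinset (edgesBetween G Finset.univ Finset.univ) h

/-- A distinguisher: it has two vertex sets, draws one answer `(u, v)` from the object and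
accepts iff `u ∈ U` and `v ∈ V`. -/
structure Distinguisher (N : ℕ) where
  U : Finset (Fin N)
  V : Finset (Fin N)

/-- The probability that `u ∈ U` and `v ∈ V` for `(u, v)` drawn from the object `B`. -/
def rectProb {N : ℕ} (B : Object N) (U V : Finset (Fin N)) : ℝ :=
  prob B {e | e.1 ∈ U ∧ e.2 ∈ V}

/-- `Pr[D^B = accept]`. -/
def Distinguisher.acceptProb {N : ℕ} (D : Distinguisher N) (B : Object N) : ℝ :=
  rectProb B D.U D.V

/-- A model is a distribution over objects. -/
abbrev Model (N : ℕ) : Type := PMF (Object N)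

/-- `M` is `ε`-indistinguishable from `B` with respect to the class `𝓓`. -/
def Indistinguishable {N : ℕ} (ε : ℝ) (B : Object N) (M : Model N)
    (𝓓 : Set (Distinguisher N)) : Prop :=
  ∀ D ∈ 𝓓, |D.acceptProb B - ∑' B' : Object N, (M B').toReal * D.acceptProb B'| ≤ ε

/-! ### Circuits deciding vertex sets -/

/-- A Boolean circuit: gate `(i, j)` adds a wire carrying the NAND of the wires `i` and `j`;
the first wires are the input bits. A missing wire carries `false`. -/
abbrev Circuit : Type := List (ℕ × ℕ)

/-- The number of gates. -/
def Circuit.size (c : Circuit) : ℕ := List.length c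

/-- The values of all wires on the input `x`. -/
def Circuit.wires (c : Circuit) (x : List Bool) : List Bool :=
  List.foldl (fun w g => w ++ [!(w.getD g.1 false && w.getD g.2 false)]) x c

/-- The output (last wire) of the circuit on the binary representation of the vertex `u`. -/
def Circuit.accepts {N : ℕ} (c : Circuit) (u : Fin N) : Bool :=
  (c.wires (List.ofFn fun i : Fin (Nat.size N) => Nat.testBit u i)).getLastD false

/-- The vertex set decided by the circuit. -/
def Circuit.toSet (N : ℕ) (c : Circuit) : Finset (Fin N) :=
  Finset.univ.filter fun u => c.accepts u = true

/-! ### Auditors -/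

/-- An algorithm with access to an object on `[N] × [N]` and query access to a predictor, given
by its execution tree. Every inner node is one step: a local computation step, a fair coin, a
sample from the object, or a query to the predictor at `(u, v)`. It ends by returning the
circuits of two vertex sets. -/
inductive AuditAlg (N : ℕ) : Type
  | ret (c d : Circuit) : AuditAlg N
  | tick (next : AuditAlg N) : AuditAlg N
  | coin (k : Bool → AuditAlg N) : AuditAlg N
  | sample (k : Fin N × Fin N → AuditAlg N) : AuditAlg N
  | query (u v : Fin N) (k : ℝ → AuditAlg N) : AuditAlg N

/-- A fair coin. -/
def fairCoin : PMF Bool := PMF.uniformOfFintype Bool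

/-- Adds `t` steps to the step count. -/
def addTime {α : Type} (t : ℕ) (μ : PMF (α × ℕ)) : PMF (α × ℕ) :=
  μ.map fun x => (x.1, t + x.2)

/-- The joint law of the two returned circuits and of the number of steps, in a run with the
object `B` and the predictor `p`. Reading a vertex takes `Nat.size N` steps, and answering the
query `p u v` takes `c u v` steps. -/
def AuditAlg.run {N : ℕ} (B : Object N) (p : Fin N → Fin N → ℝ) (c : Fin N → Fin N → ℕ) :
    AuditAlg N → PMF ((Circuit × Circuit) × ℕ)
  | .ret a b => PMF.pure ((a, b), 1)
  | .tick next => addTime 1 (next.run B p c)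
  | .coin k => addTime 1 (fairCoin.bind fun b => (k b).run B p c)
  | .sample k => addTime (1 + 2 * Nat.size N) (B.bind fun e => (k e).run B p c)
  | .query u v k => addTime (1 + c u v) ((k (p u v)).run B p c)

/-- The algorithm makes at most `n` steps, whatever answers it receives. -/
def AuditAlg.TimeLE {N : ℕ} : AuditAlg N → ℕ → Prop
  | .ret _ _, _ => True
  | .tick _, 0 => False
  | .tick next, n + 1 => next.TimeLE n
  | .coin _, 0 => False
  | .coin k, n + 1 => ∀ b, (k b).TimeLE n
  | .sample _, 0 => False
  | .sample k, n + 1 => ∀ e, (k e).TimeLE n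
  | .query _ _ _, 0 => False
  | .query _ _ k, n + 1 => ∀ x ∈ Set.Icc (0 : ℝ) 1, (k x).TimeLE n

/-- The algorithm always returns circuits of size at most `w`. -/
def AuditAlg.OutputLE {N : ℕ} (w : ℕ) : AuditAlg N → Prop
  | .ret a b => a.size ≤ w ∧ b.size ≤ w
  | .tick next => next.OutputLE w
  | .coin k => ∀ b, (k b).OutputLE w
  | .sample k => ∀ e, (k e).OutputLE w
  | .query _ _ k => ∀ x ∈ Set.Icc (0 : ℝ) 1, (k x).OutputLE w

/-- `Pr[u ∈ U, v ∈ V]` for `(u, v) ∼ p`, where a pair has probability proportional to its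
`p`-value. -/
def predProb {N : ℕ} (p : Fin N → Fin N → ℝ) (U V : Finset (Fin N)) : ℝ :=
  (∑ u ∈ U, ∑ v ∈ V, p u v) / ∑ u, ∑ v, p u v

/-- `Λ` is an `(ε, ε', δ)`-auditor for the collection `𝓒` of pairs of vertex sets, on the objects
of the class `𝓑`: whenever some pair of `𝓒` has a gap of absolute value at least `ε` between the
object and a predictor `p`, then with probability at least `1 - δ` the returned pair has a gap of
absolute value at least `ε'`. The distribution `(u, v) ∼ p` needs `p` not to vanish identically. -/
def IsAuditor {N : ℕ} (Λ : AuditAlg N) (ε ε' δ : ℝ) (𝓑 : Set (Object N))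
    (𝓒 : Set (Finset (Fin N) × Finset (Fin N))) : Prop :=
  ∀ B ∈ 𝓑, ∀ p : Fin N → Fin N → ℝ, (∀ u v, p u v ∈ Set.Icc (0 : ℝ) 1) →
    0 < ∑ u, ∑ v, p u v →
    (∃ S ∈ 𝓒, ε ≤ |rectProb B S.1 S.2 - predProb p S.1 S.2|) →
    1 - δ ≤ prob (Λ.run B p fun _ _ => 0)
      {x | ε' ≤ |rectProb B (x.1.1.toSet N) (x.1.2.toSet N)
        - predProb p (x.1.1.toSet N) (x.1.2.toSet N)|}

/-! ### Learners and implementations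

Learners and implementations are finite program texts. They mention neither `N` nor vertices nor
vertex sets: vertices and circuits are kept in numbered registers and are accessed only through
the instructions below, each of which is charged in the step count. -/

/-- The membership test: is the vertex in register `i` in the first (`side = false`) or the second
(`side = true`) set of the pair of circuits in register `s`? The answer comes with the number of
steps, which accounts for the evaluation of the circuit. An empty register gives `false`. -/
def memTest {N : ℕ} (sets : List (Circuit × Circuit)) (verts : List (Fin N))
    (side : Bool) (s i : ℕ) : Bool × ℕ :=
  match sets[s]?, verts[i]? with
  | some c, some u =>
      ((if side then c.2 else c.1).accepts u, 1 + (if side then c.2 else c.1).size)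
  | _, _ => (false, 1)

/-- The code of a predictor. The inputs `u`, `v` are the vertex registers `0`, `1`. -/
inductive PredCode : Type
  | val (q : Set.Icc (0 : ℚ) 1) : PredCode
  | test (side : Bool) (s i : ℕ) (yes no : PredCode) : PredCode

/-- The value at `(u, v)` and the number of steps taken to compute it. -/
def PredCode.eval {N : ℕ} (sets : List (Circuit × Circuit)) (u v : Fin N) : PredCode → ℝ × ℕ
  | .val q => (((q : ℚ) : ℝ), 1)
  | .test side s i yes no =>
      let b := memTest sets [u, v] side s i
      let y := if b.1 then yes.eval sets u v else no.eval sets u v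
      (y.1, b.2 + y.2)

/-- The code of an implementation: draw a uniform vertex into the next register, flip a fair coin,
look at bit `i` of the seed, test membership, output the pair of vertices in two registers, or
start again from the beginning with fresh coins and vertices (but the same seed). -/
inductive SamplerCode : Type
  | vertex (next : SamplerCode) : SamplerCode
  | coin (heads tails : SamplerCode) : SamplerCode
  | seed (i : ℕ) (one zero : SamplerCode) : SamplerCode
  | test (side : Bool) (s i : ℕ) (yes no : SamplerCode) : SamplerCode
  | output (i j : ℕ) : SamplerCode
  | restart : SamplerCode

open Classical in
/-- One pass through the code, up to an output or a restart (`none`), with its number of steps.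
If `[N]` is empty no vertex can be drawn. -/
def SamplerCode.pass {N : ℕ} (sets : List (Circuit × Circuit)) (r : ℕ → Bool) :
    SamplerCode → List (Fin N) → PMF (Option (Fin N × Fin N) × ℕ)
  | .vertex next, vs =>
      if _h : Nonempty (Fin N) then
        addTime (1 + Nat.size N)
          ((PMF.uniformOfFintype (Fin N)).bind fun u => next.pass sets r (vs ++ [u]))
      else PMF.pure (none, 1)
  | .coin a b, vs => addTime 1 (fairCoin.bind fun x =>
      if x then a.pass sets r vs else b.pass sets r vs)
  | .seed i a b, vs => addTime 1 (if r i then a.pass sets r vs else b.pass sets r vs)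
  | .test side s i a b, vs =>
      addTime (memTest sets vs side s i).2
        (if (memTest sets vs side s i).1 then a.pass sets r vs else b.pass sets r vs)
  | .output i j, vs =>
      match vs[i]?, vs[j]? with
      | some u, some v => PMF.pure (some (u, v), 1 + 2 * Nat.size N)
      | _, _ => PMF.pure (none, 1)
  | .restart, _ => PMF.pure (none, 1)

/-- Repeats a trial until it succeeds, but at most `n` times; the step counts add up. -/
def attempts {α : Type} (μ : PMF (Option α × ℕ)) : ℕ → PMF (Option α × ℕ)
  | 0 => PMF.pure (none, 0)
  | n + 1 => μ.bind fun x =>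
      match x.1 with
      | some a => PMF.pure (some a, x.2)
      | none => addTime x.2 (attempts μ n)

/-- An implementation `T`: the length of its seed, its code, and the circuits that the code
refers to. -/
structure Implementation where
  seedLen : ℕ
  code : SamplerCode
  sets : List (Circuit × Circuit)

/-- The run `T(r)` with seed `r`, cut off after `n` passes. -/
def Implementation.runUpTo (N : ℕ) (T : Implementation) (r : Fin T.seedLen → Bool) (n : ℕ) :
    PMF (Option (Fin N × Fin N) × ℕ) :=
  attempts (T.code.pass T.sets (fun i => if h : i < T.seedLen then r ⟨i, h⟩ else false) []) n

/-- `T` is an (ordinary) implementation of the model `M`: for every seed `r` there is an object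
`B r` such that `T(r)` halts almost surely with an answer distributed according to `B r`, and
`B r` is distributed according to `M` for a uniform seed `r`. -/
def Implementation.Implements {N : ℕ} (T : Implementation) (M : Model N) : Prop :=
  ∃ B : (Fin T.seedLen → Bool) → Object N,
    (∀ r e, Tendsto (fun n => (T.runUpTo N r n).toOuterMeasure {x | x.1 = some e})
      atTop (𝓝 (B r e))) ∧
    M = (PMF.uniformOfFintype (Fin T.seedLen → Bool)).map B

/-- For every seed, the expected number of steps of the implementation is at most `t`. -/
def Implementation.ExpectedTimeLE (N : ℕ) (T : Implementation) (t : ℕ) : Prop :=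
  ∀ (r : Fin T.seedLen → Bool) (n : ℕ), ∑' x, T.runUpTo N r n x * (x.2 : ℝ≥0∞) ≤ (t : ℝ≥0∞)

/-- The code of a learner: draw a sample of the object into the next two vertex registers, draw a
uniform vertex into the next register, flip a fair coin, test membership, run the auditor (with
access to the same object) on the predictor `p` and put the returned pair of circuits into the
next circuit register, or output an implementation. -/
inductive Learner : Type
  | sample (next : Learner) : Learner
  | vertex (next : Learner) : Learner
  | coin (heads tails : Learner) : Learner
  | test (side : Bool) (s i : ℕ) (yes no : Learner) : Learner
  | audit (p : PredCode) (next : Learner) : Learner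
  | output (seedLen : ℕ) (code : SamplerCode) : Learner

/-- The joint law of the output and of the number of steps when the learner runs with the auditor
`Λ` on the object `B`. The steps of the auditor count, and so does the work of answering its
queries to the predictor. -/
def Learner.runFrom {N : ℕ} (Λ : AuditAlg N) (B : Object N) :
    Learner → List (Fin N) → List (Circuit × Circuit) → PMF (Implementation × ℕ)
  | .sample next, vs, cs => addTime (1 + 2 * Nat.size N)
      (B.bind fun e => next.runFrom Λ B (vs ++ [e.1, e.2]) cs)
  | .vertex next, vs, cs => addTime (1 + Nat.size N)
      (haveI : Nonempty (Fin N) := ⟨B.support_nonempty.some.1⟩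
       (PMF.uniformOfFintype (Fin N)).bind fun u => next.runFrom Λ B (vs ++ [u]) cs)
  | .coin a b, vs, cs => addTime 1 (fairCoin.bind fun x =>
      if x then a.runFrom Λ B vs cs else b.runFrom Λ B vs cs)
  | .test side s i a b, vs, cs =>
      addTime (memTest cs vs side s i).2
        (if (memTest cs vs side s i).1 then a.runFrom Λ B vs cs else b.runFrom Λ B vs cs)
  | .audit p next, vs, cs => addTime 1
      ((Λ.run B (fun u v => (p.eval cs u v).1) (fun u v => (p.eval cs u v).2)).bind fun x =>
        addTime x.2 (next.runFrom Λ B vs (cs ++ [x.1])))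
  | .output l code, _, cs => PMF.pure (⟨l, code, cs⟩, 1)

/-- The run of the learner from empty registers. -/
def Learner.run {N : ℕ} (L : Learner) (Λ : AuditAlg N) (B : Object N) :
    PMF (Implementation × ℕ) :=
  L.runFrom Λ B [] []

/-- `L`, using `Λ` as a subroutine, is an `(ε, δ)`-learner for the class `𝓑` with respect to `𝓓`:
on every object of `𝓑` it always outputs an implementation of a model, and with probability at
least `1 - δ` this model is `ε`-indistinguishable from the object. -/
def IsLearner {N : ℕ} (L : Learner) (Λ : AuditAlg N) (ε δ : ℝ) (𝓑 : Set (Object N))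
    (𝓓 : Set (Distinguisher N)) : Prop :=
  ∀ B ∈ 𝓑,
    (∀ x ∈ (L.run Λ B).support, ∃ M : Model N, x.1.Implements M) ∧
    1 - δ ≤ prob (L.run Λ B)
      {x | ∃ M : Model N, x.1.Implements M ∧ Indistinguishable ε B M 𝓓}

end SparseGraph

end

/-! The learner runs multiplicative weights over pairs. A pair starts with weight 1 and loses a
factor 1 - a, where a = 2⁻ᵏ, for every update it disagrees with; an update favours a rectangle or
its complement. Progress is measured by the log-likelihood of the normalised weight w under the
object: `potential` is 8γ minus the B-average of log(w · N² / ∑ w).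

A round asks the auditor for a rectangle, then draws one pair from the object and one from the
weight. If exactly one of them is in the rectangle, the side containing the weight's pair is
penalised. Neither the size nor the sign of the gap has to be estimated: if β and q are the masses
of the rectangle, the two updates occur with probabilities β(1 - q) and q(1 - β), which differ by
exactly β - q, so the potential falls on average by a(β - q)², up to an error 2a²
(`logLik_penalize`, `average_update_le`).

Upper uniformity keeps the potential nonnegative. A random bipartition extends the density bound
from disjoint sets to all rectangles at the price of a factor 4 (`exists_bipartition`,
`rectProb_le_of_upperUniform`). Each update at most doubles the additive error of this bound
(`DominatedOnRects.penalize`), while the weight stays at least 2⁻ᵀ after T updates; with η = 4⁻ᵀ the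
error never exceeds the mean weight, so the B-average of w is at most 8γ times its mean
(`potential_nonneg`).

Hence the expected number of rounds that start from a distinguishable weight is bounded in terms of
γ and the drift 2a² (`sum_roundsValue_le`), and stopping after a uniformly random number of rounds
gives a distinguishable weight with probability at most δ''.

Since the mean weight is at least 2⁻ᵀ, rejection sampling needs at most 2ᵀ passes in expectation,
independently of N. Inside the learner it is cut off after 2ᵀ attempts, which keeps half of the
progress. The program depends only on k and the number of rounds, so N enters the running time only
through vertex reads, circuit evaluations and auditor calls. -/

noncomputable section

namespace SparseGraph

/-! ### Expectations under laws with a step count -/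

/-- The expectation of a function of the outcome, where the step count is ignored. -/
def expect {α : Type} (μ : PMF (α × ℕ)) (h : α → ℝ≥0∞) : ℝ≥0∞ := ∑' x, μ x * h x.1

lemma tsum_bind_mul {α β : Type} (μ : PMF α) (k : α → PMF β) (g : β → ℝ≥0∞) :
    ∑' b, (μ.bind k) b * g b = ∑' a, μ a * ∑' b, k a b * g b := by
  simp only [PMF.bind_apply, ← ENNReal.tsum_mul_right, ← ENNReal.tsum_mul_left]
  rw [ENNReal.tsum_comm]
  simp only [mul_assoc]

lemma tsum_pure_mul {α : Type} (a : α) (g : α → ℝ≥0∞) : ∑' b, PMF.pure a b * g b = g a := by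
  rw [tsum_eq_single a]
  · simp
  · intro b hb
    simp [PMF.pure_apply, hb]

lemma tsum_map_mul {α β : Type} (μ : PMF α) (f : α → β) (g : β → ℝ≥0∞) :
    ∑' b, (μ.map f) b * g b = ∑' a, μ a * g (f a) := by
  rw [← PMF.bind_pure_comp, tsum_bind_mul]
  simp only [Function.comp, tsum_pure_mul]

lemma expect_pure {α : Type} (a : α) (t : ℕ) (h : α → ℝ≥0∞) :
    expect (PMF.pure (a, t)) h = h a := tsum_pure_mul (a, t) fun x => h x.1

lemma expect_bind {α β : Type} (μ : PMF β) (k : β → PMF (α × ℕ)) (h : α → ℝ≥0∞) :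
    expect (μ.bind k) h = ∑' b, μ b * expect (k b) h := tsum_bind_mul μ k fun x => h x.1

lemma expect_addTime {α : Type} (t : ℕ) (μ : PMF (α × ℕ)) (h : α → ℝ≥0∞) :
    expect (addTime t μ) h = expect μ h :=
  tsum_map_mul μ (fun x => (x.1, t + x.2)) fun x : α × ℕ => h x.1

lemma expect_fairCoin {α : Type} (k : Bool → PMF (α × ℕ)) (h : α → ℝ≥0∞) :
    expect (fairCoin.bind k) h = 2⁻¹ * expect (k true) h + 2⁻¹ * expect (k false) h := by
  rw [expect_bind, tsum_fintype]
  simp [fairCoin]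

lemma expect_mono {α : Type} (μ : PMF (α × ℕ)) {g h : α → ℝ≥0∞} (hgh : ∀ a, g a ≤ h a) :
    expect μ g ≤ expect μ h :=
  ENNReal.tsum_le_tsum fun x => mul_le_mul_right (hgh x.1) _

lemma expect_const {α : Type} (μ : PMF (α × ℕ)) (c : ℝ≥0∞) : expect μ (fun _ => c) = c := by
  rw [expect, ENNReal.tsum_mul_right, PMF.tsum_coe, one_mul]

lemma expect_add {α : Type} (μ : PMF (α × ℕ)) (g h : α → ℝ≥0∞) :
    expect μ (fun a => g a + h a) = expect μ g + expect μ h := by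
  simp only [expect, mul_add, ENNReal.tsum_add]

lemma expect_mul_const {α : Type} (μ : PMF (α × ℕ)) (g : α → ℝ≥0∞) (c : ℝ≥0∞) :
    expect μ (fun a => g a * c) = expect μ g * c := by
  simp only [expect, ← mul_assoc, ENNReal.tsum_mul_right]

lemma toOuterMeasure_eq_expect {α : Type} (μ : PMF (α × ℕ)) (s : Set α)
    [DecidablePred (· ∈ s)] :
    μ.toOuterMeasure {x | x.1 ∈ s} = expect μ (fun a => if a ∈ s then 1 else 0) := by
  rw [PMF.toOuterMeasure_apply, expect]
  refine tsum_congr fun x => ?_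
  by_cases h : x.1 ∈ s <;> simp [Set.indicator, h]

lemma mem_support_addTime {α : Type} {t : ℕ} {μ : PMF (α × ℕ)} {x : α × ℕ}
    (hx : x ∈ (addTime t μ).support) : ∃ y ∈ μ.support, x.1 = y.1 ∧ x.2 = t + y.2 := by
  rw [addTime, PMF.mem_support_map_iff] at hx
  obtain ⟨y, hy, rfl⟩ := hx
  exact ⟨y, hy, rfl, rfl⟩

/-! ### Step counts -/

lemma size_le_one_add_log (N : ℕ) : Nat.size N ≤ 1 + Nat.log 2 N := by
  rw [Nat.size_le, add_comm]
  exact Nat.lt_pow_succ_log_self one_lt_two N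

/-- All circuits in the registers have size at most `W`. -/
def SizesLE (cs : List (Circuit × Circuit)) (W : ℕ) : Prop :=
  ∀ c ∈ cs, c.1.size ≤ W ∧ c.2.size ≤ W

lemma SizesLE.append_singleton {cs : List (Circuit × Circuit)} {W : ℕ} (h : SizesLE cs W)
    {c : Circuit × Circuit} (hc : c.1.size ≤ W ∧ c.2.size ≤ W) : SizesLE (cs ++ [c]) W := by
  intro d hd
  rcases List.mem_append.1 hd with hd | hd
  · exact h d hd
  · rw [List.mem_singleton.1 hd]
    exact hc

lemma memTest_time_le {N W : ℕ} {cs : List (Circuit × Circuit)} (h : SizesLE cs W)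
    (vs : List (Fin N)) (side : Bool) (s i : ℕ) : (memTest cs vs side s i).2 ≤ 1 + W := by
  unfold memTest
  split
  · rename_i c u hc hu
    have := h c (List.mem_of_getElem? hc)
    cases side <;> simp [this]
  · simp

/-- The number of instructions of the code of a predictor. -/
def PredCode.cost : PredCode → ℕ
  | .val _ => 1
  | .test _ _ _ yes no => 1 + (yes.cost + no.cost)

lemma PredCode.eval_mem_Icc {N : ℕ} (cs : List (Circuit × Circuit)) (u v : Fin N) :
    ∀ p : PredCode, (p.eval cs u v).1 ∈ Set.Icc (0 : ℝ) 1
  | .val q => by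
      have := q.2
      simp only [PredCode.eval, Set.mem_Icc] at this ⊢
      exact_mod_cast this
  | .test side s i yes no => by
      simp only [PredCode.eval]
      split
      · exact eval_mem_Icc cs u v yes
      · exact eval_mem_Icc cs u v no

lemma PredCode.eval_time_le {N W : ℕ} {cs : List (Circuit × Circuit)} (h : SizesLE cs W)
    (u v : Fin N) : ∀ p : PredCode, (p.eval cs u v).2 ≤ p.cost * (1 + W)
  | .val q => by simp [PredCode.eval, PredCode.cost]
  | .test side s i yes no => by
      have h₀ := memTest_time_le h [u, v] side s i
      have h₁ := eval_time_le h u v yes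
      have h₂ := eval_time_le h u v no
      simp only [PredCode.eval, PredCode.cost]
      split <;> linarith [Nat.zero_le (yes.cost * (1 + W)), Nat.zero_le (no.cost * (1 + W))]

/-- The leading 1 pays for the final `ret`; the other factor bounds any single inner step. `hp` is
needed because `TimeLE` and `OutputLE` only constrain the branches for answers in [0, 1]. -/
lemma AuditAlg.run_support {N : ℕ} {B : Object N} {p : Fin N → Fin N → ℝ}
    {c : Fin N → Fin N → ℕ} {M W : ℕ} (hp : ∀ u v, p u v ∈ Set.Icc (0 : ℝ) 1)
    (hc : ∀ u v, c u v ≤ M) (Λ : AuditAlg N) :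
    ∀ n, Λ.TimeLE n → Λ.OutputLE W → ∀ x ∈ (Λ.run B p c).support,
      (x.1.1.size ≤ W ∧ x.1.2.size ≤ W) ∧ x.2 ≤ 1 + n * (1 + 2 * Nat.size N + M) := by
  induction Λ with
  | ret a b =>
    intro n _ hW x hx
    rw [AuditAlg.run, PMF.mem_support_pure_iff] at hx
    subst hx
    exact ⟨hW, by simp⟩
  | tick next ih =>
    rintro (_ | n) hn hW x hx
    · exact hn.elim
    obtain ⟨y, hy, h₁, h₂⟩ := mem_support_addTime hx
    have := ih n hn hW y hy
    rw [h₁, h₂]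
    exact ⟨this.1, by linarith [this.2]⟩
  | coin k ih =>
    rintro (_ | n) hn hW x hx
    · exact hn.elim
    obtain ⟨y, hy, h₁, h₂⟩ := mem_support_addTime hx
    obtain ⟨b, _, hy⟩ := (PMF.mem_support_bind_iff _ _ _).1 hy
    have := ih b n (hn b) (hW b) y hy
    rw [h₁, h₂]
    exact ⟨this.1, by linarith [this.2]⟩
  | sample k ih =>
    rintro (_ | n) hn hW x hx
    · exact hn.elim
    obtain ⟨y, hy, h₁, h₂⟩ := mem_support_addTime hx
    obtain ⟨b, _, hy⟩ := (PMF.mem_support_bind_iff _ _ _).1 hy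
    have := ih b n (hn b) (hW b) y hy
    rw [h₁, h₂]
    exact ⟨this.1, by linarith [this.2]⟩
  | query u v k ih =>
    rintro (_ | n) hn hW x hx
    · exact hn.elim
    obtain ⟨y, hy, h₁, h₂⟩ := mem_support_addTime hx
    have := ih (p u v) n (hn _ (hp u v)) (hW _ (hp u v)) y hy
    rw [h₁, h₂]
    exact ⟨this.1, by linarith [this.2, hc u v]⟩

/-- The auditor's guarantee is stated with free queries, whereas the learner pays for evaluating its
predictor. Prices change only the step count. -/
lemma AuditAlg.expect_run {N : ℕ} (B : Object N) (p : Fin N → Fin N → ℝ)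
    (c c' : Fin N → Fin N → ℕ) (h : Circuit × Circuit → ℝ≥0∞) (Λ : AuditAlg N) :
    expect (Λ.run B p c) h = expect (Λ.run B p c') h := by
  induction Λ with
  | ret a b => rfl
  | tick next ih => simp only [AuditAlg.run, expect_addTime, ih]
  | coin k ih => simp only [AuditAlg.run, expect_addTime, expect_bind, ih]
  | sample k ih => simp only [AuditAlg.run, expect_addTime, expect_bind, ih]
  | query u v k ih => simp only [AuditAlg.run, expect_addTime, ih]

/-- The number of instructions of a sampler, with weights. -/
def SamplerCode.cost : SamplerCode → ℕ
  | .vertex next => 2 + next.cost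
  | .coin a b => 1 + (a.cost + b.cost)
  | .seed _ a b => 1 + (a.cost + b.cost)
  | .test _ _ _ a b => 1 + (a.cost + b.cost)
  | .output _ _ => 3
  | .restart => 1

lemma SamplerCode.pass_time_le {N W : ℕ} {cs : List (Circuit × Circuit)} (h : SizesLE cs W)
    (r : ℕ → Bool) (S : SamplerCode) : ∀ vs : List (Fin N), ∀ x ∈ (S.pass cs r vs).support,
      x.2 ≤ S.cost * ((1 + Nat.log 2 N) * (1 + W)) := by
  have hs := size_le_one_add_log N
  have hX : 1 + Nat.log 2 N ≤ (1 + Nat.log 2 N) * (1 + W) := Nat.le_mul_of_pos_right _ (by omega)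
  have hW : 1 + W ≤ (1 + Nat.log 2 N) * (1 + W) := Nat.le_mul_of_pos_left _ (by omega)
  -- Only these two lower bounds on the product matter; hiding it leaves linear goals.
  generalize (1 + Nat.log 2 N) * (1 + W) = X at hX hW
  induction S with
  | vertex next ih =>
    intro vs x hx
    simp only [SamplerCode.pass, SamplerCode.cost] at hx ⊢
    split at hx
    · obtain ⟨y, hy, -, h₂⟩ := mem_support_addTime hx
      obtain ⟨b, _, hy⟩ := (PMF.mem_support_bind_iff _ _ _).1 hy
      have := ih _ y hy
      rw [h₂, add_mul]
      omega
    · rw [PMF.mem_support_pure_iff] at hx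
      rw [hx, add_mul]
      have := Nat.zero_le (next.cost * X)
      dsimp only
      omega
  | coin a b iha ihb =>
    intro vs x hx
    obtain ⟨y, hy, -, h₂⟩ := mem_support_addTime hx
    obtain ⟨b, _, hy⟩ := (PMF.mem_support_bind_iff _ _ _).1 hy
    rw [h₂, SamplerCode.cost, add_mul, add_mul]
    split at hy
    · have := iha _ y hy
      omega
    · have := ihb _ y hy
      omega
  | seed i a b iha ihb =>
    intro vs x hx
    obtain ⟨y, hy, -, h₂⟩ := mem_support_addTime hx
    rw [h₂, SamplerCode.cost, add_mul, add_mul]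
    split at hy
    · have := iha _ y hy
      omega
    · have := ihb _ y hy
      omega
  | test side s i a b iha ihb =>
    intro vs x hx
    obtain ⟨y, hy, -, h₂⟩ := mem_support_addTime hx
    have h₀ := memTest_time_le h vs side s i
    rw [h₂, SamplerCode.cost, add_mul, add_mul]
    split at hy
    · have := iha _ y hy
      omega
    · have := ihb _ y hy
      omega
  | output i j =>
    intro vs x hx
    simp only [SamplerCode.pass, SamplerCode.cost] at hx ⊢
    split at hx <;> rw [PMF.mem_support_pure_iff] at hx <;> rw [hx] <;> dsimp only <;> omega
  | restart =>
    intro vs x hx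
    simp only [SamplerCode.pass, SamplerCode.cost, PMF.mem_support_pure_iff] at hx ⊢
    rw [hx]
    dsimp only
    omega

/-- The number of instructions of a learner, with weights. -/
def Learner.cost : Learner → ℕ
  | .sample next => 3 + next.cost
  | .vertex next => 2 + next.cost
  | .coin a b => 1 + (a.cost + b.cost)
  | .test _ _ _ a b => 1 + (a.cost + b.cost)
  | .audit p next => (5 + p.cost) + next.cost
  | .output _ _ => 1

/-- The total cost of the samplers that occur in a learner. -/
def Learner.samplerCost : Learner → ℕ
  | .sample next => next.samplerCost
  | .vertex next => next.samplerCost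
  | .coin a b => a.samplerCost + b.samplerCost
  | .test _ _ _ a b => a.samplerCost + b.samplerCost
  | .audit _ next => next.samplerCost
  | .output _ code => code.cost

/-- Every output instruction of the learner satisfies `P`. -/
def Learner.AllOutputs (P : ℕ → SamplerCode → Prop) : Learner → Prop
  | .sample next => next.AllOutputs P
  | .vertex next => next.AllOutputs P
  | .coin a b => a.AllOutputs P ∧ b.AllOutputs P
  | .test _ _ _ a b => a.AllOutputs P ∧ b.AllOutputs P
  | .audit _ next => next.AllOutputs P
  | .output l code => P l code

/-- The shape of the emitted sampler is read off the program text, whatever the auditor and the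
object answer. -/
lemma Learner.allOutputs_of_mem_support {N : ℕ} {Λ : AuditAlg N} {B : Object N}
    {P : ℕ → SamplerCode → Prop} (L : Learner) :
    L.AllOutputs P → ∀ vs cs, ∀ x ∈ (L.runFrom Λ B vs cs).support, P x.1.seedLen x.1.code := by
  induction L with
  | sample next ih | vertex next ih =>
    intro hP vs cs x hx
    obtain ⟨y, hy, h₁, -⟩ := mem_support_addTime hx
    obtain ⟨b, _, hy⟩ := (PMF.mem_support_bind_iff _ _ _).1 hy
    rw [h₁]
    exact ih hP _ _ y hy
  | coin a b iha ihb =>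
    intro hP vs cs x hx
    obtain ⟨y, hy, h₁, -⟩ := mem_support_addTime hx
    obtain ⟨b, _, hy⟩ := (PMF.mem_support_bind_iff _ _ _).1 hy
    rw [h₁]
    split at hy
    · exact iha hP.1 _ _ y hy
    · exact ihb hP.2 _ _ y hy
  | test side s i a b iha ihb =>
    intro hP vs cs x hx
    obtain ⟨y, hy, h₁, -⟩ := mem_support_addTime hx
    rw [h₁]
    split at hy
    · exact iha hP.1 _ _ y hy
    · exact ihb hP.2 _ _ y hy
  | audit p next ih =>
    intro hP vs cs x hx
    obtain ⟨y, hy, h₁, -⟩ := mem_support_addTime hx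
    obtain ⟨b, _, hy⟩ := (PMF.mem_support_bind_iff _ _ _).1 hy
    obtain ⟨z, hz, h₂, -⟩ := mem_support_addTime hy
    rw [h₁, h₂]
    exact ih hP _ _ z hz
  | output l code =>
    intro hP vs cs x hx
    rw [Learner.runFrom, PMF.mem_support_pure_iff] at hx
    rw [hx]
    exact hP

lemma Learner.run_support {N : ℕ} {Λ : AuditAlg N} {B : Object N} {W₁ W₂ : ℕ}
    (hΛ₁ : Λ.TimeLE W₁) (hΛ₂ : Λ.OutputLE W₂) (L : Learner) :
    ∀ vs cs, SizesLE cs W₂ → ∀ x ∈ (L.runFrom Λ B vs cs).support,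
      x.2 ≤ L.cost * ((1 + Nat.log 2 N) * (1 + W₁) * (1 + W₂)) ∧
      SizesLE x.1.sets W₂ ∧ x.1.code.cost ≤ L.samplerCost := by
  have hs := size_le_one_add_log N
  have hlog : 1 + Nat.log 2 N ≤ (1 + Nat.log 2 N) * (1 + W₁) * (1 + W₂) := by
    rw [mul_assoc]
    exact Nat.le_mul_of_pos_right _ (by positivity)
  have hW : 1 + W₂ ≤ (1 + Nat.log 2 N) * (1 + W₁) * (1 + W₂) :=
    Nat.le_mul_of_pos_left _ (by positivity)
  have hA : W₁ * (1 + Nat.log 2 N) ≤ (1 + Nat.log 2 N) * (1 + W₁) * (1 + W₂) := by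
    rw [mul_comm]
    calc (1 + Nat.log 2 N) * W₁ ≤ (1 + Nat.log 2 N) * (1 + W₁) :=
          Nat.mul_le_mul_left _ (by omega)
      _ ≤ _ := Nat.le_mul_of_pos_right _ (by omega)
  have hB : W₁ * (1 + W₂) ≤ (1 + Nat.log 2 N) * (1 + W₁) * (1 + W₂) := by
    refine Nat.mul_le_mul_right _ ?_
    calc W₁ ≤ 1 + W₁ := by omega
      _ ≤ _ := Nat.le_mul_of_pos_left _ (by omega)
  generalize (1 + Nat.log 2 N) * (1 + W₁) * (1 + W₂) = X at hlog hW hA hB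
  induction L with
  | sample next ih | vertex next ih =>
    intro vs cs hcs x hx
    obtain ⟨y, hy, h₁, h₂⟩ := mem_support_addTime hx
    obtain ⟨b, _, hy⟩ := (PMF.mem_support_bind_iff _ _ _).1 hy
    have := ih _ _ hcs y hy
    rw [h₁, h₂, Learner.cost, add_mul]
    exact ⟨by omega, this.2⟩
  | coin a b iha ihb =>
    intro vs cs hcs x hx
    obtain ⟨y, hy, h₁, h₂⟩ := mem_support_addTime hx
    obtain ⟨b, _, hy⟩ := (PMF.mem_support_bind_iff _ _ _).1 hy
    rw [h₁, h₂, Learner.cost, Learner.samplerCost, add_mul, add_mul]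
    split at hy
    · have := iha _ _ hcs y hy
      exact ⟨by omega, this.2.1, by omega⟩
    · have := ihb _ _ hcs y hy
      exact ⟨by omega, this.2.1, by omega⟩
  | test side s i a b iha ihb =>
    intro vs cs hcs x hx
    obtain ⟨y, hy, h₁, h₂⟩ := mem_support_addTime hx
    have h₀ := memTest_time_le hcs vs side s i
    rw [h₁, h₂, Learner.cost, Learner.samplerCost, add_mul, add_mul]
    split at hy
    · have := iha _ _ hcs y hy
      exact ⟨by omega, this.2.1, by omega⟩
    · have := ihb _ _ hcs y hy
      exact ⟨by omega, this.2.1, by omega⟩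
  | audit p next ih =>
    intro vs cs hcs x hx
    obtain ⟨y, hy, h₁, h₂⟩ := mem_support_addTime hx
    obtain ⟨b, hb, hy⟩ := (PMF.mem_support_bind_iff _ _ _).1 hy
    obtain ⟨z, hz, h₃, h₄⟩ := mem_support_addTime hy
    have hb' := AuditAlg.run_support (fun u v => p.eval_mem_Icc cs u v)
      (fun u v => p.eval_time_le hcs u v) Λ W₁ hΛ₁ hΛ₂ b hb
    have := ih _ _ (hcs.append_singleton hb'.1) z hz
    rw [h₁, h₂, h₃, h₄, Learner.cost, add_mul]
    refine ⟨?_, this.2⟩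
    -- Each auditor step is charged for reading a sampled pair and for one predictor evaluation. Of
    -- the weight 5 in `Learner.cost`, 3 goes here and 2 to the call itself and the final `ret`.
    have h₅ : W₁ * (1 + 2 * Nat.size N + p.cost * (1 + W₂)) ≤ (3 + p.cost) * X := by
      calc W₁ * (1 + 2 * Nat.size N + p.cost * (1 + W₂))
          ≤ W₁ * (3 * (1 + Nat.log 2 N) + p.cost * (1 + W₂)) :=
            Nat.mul_le_mul_left _ (by omega)
        _ = 3 * (W₁ * (1 + Nat.log 2 N)) + p.cost * (W₁ * (1 + W₂)) := by ring
        _ ≤ 3 * X + p.cost * X := by gcongr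
        _ = _ := by ring
    have h₆ : (5 + p.cost) * X = 2 * X + (3 + p.cost) * X := by ring
    omega
  | output l code =>
    intro vs cs hcs x hx
    rw [Learner.runFrom, PMF.mem_support_pure_iff] at hx
    rw [hx]
    exact ⟨by simp only [Learner.cost]; omega, hcs, le_rfl⟩

/-! ### Log-likelihood under multiplicative updates -/

/-- The expected logarithm, under the weights `b`, of the distribution proportional to `f`. -/
def logLik {Ω : Type} [Fintype Ω] (b f : Ω → ℝ) : ℝ :=
  ∑ ω, b ω * Real.log (f ω) - Real.log (∑ ω, f ω)

lemma neg_sub_two_sq_le_log_one_sub {a : ℝ} (h₁ : a ≤ 1 / 2) :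
    -a - 2 * a ^ 2 ≤ Real.log (1 - a) := by
  refine le_trans ?_ (Real.one_sub_inv_le_log_of_pos (by linarith))
  have h : 0 < 1 - a := by linarith
  have : (1 - a)⁻¹ ≤ 1 + a + 2 * a ^ 2 := by
    rw [inv_le_iff_one_le_mul₀ h]
    nlinarith [sq_nonneg a, mul_nonneg (sq_nonneg a) (by linarith : (0 : ℝ) ≤ 1 - 2 * a)]
  linarith

/-- The normaliser is multiplied by 1 - a q/Z, whose logarithm is at most -a q/Z, and the average
log-weight changes by c log(1 - a) ≥ -c(a + 2a²). To first order the gain is a times the excess of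
the weight's mass of `S` over its b-mass. -/
lemma logLik_penalize {Ω : Type} [Fintype Ω] [Nonempty Ω] {b f : Ω → ℝ} (hb : ∀ ω, 0 ≤ b ω)
    (hf : ∀ ω, 0 < f ω) (S : Ω → Prop) [DecidablePred S] {a : ℝ} (h₀ : 0 ≤ a) (h₁ : a ≤ 1 / 2) :
    logLik b f + a * ((∑ ω, if S ω then f ω else 0) / ∑ ω, f ω)
      - (a + 2 * a ^ 2) * (∑ ω, if S ω then b ω else 0)
      ≤ logLik b (fun ω => f ω * if S ω then 1 - a else 1) := by
  set Z := ∑ ω, f ω with hZ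
  set q := ∑ ω, if S ω then f ω else 0 with hq
  set c := ∑ ω, if S ω then b ω else 0 with hc
  have hZ0 : 0 < Z := Finset.sum_pos (fun ω _ => hf ω) Finset.univ_nonempty
  have hqZ : q ≤ Z := Finset.sum_le_sum fun ω _ => by split <;> simp [(hf ω).le]
  have hc0 : 0 ≤ c := Finset.sum_nonneg fun ω _ => by split <;> simp [hb ω]
  have e₁ : ∑ ω, b ω * Real.log (f ω * if S ω then 1 - a else 1)
      = ∑ ω, b ω * Real.log (f ω) + c * Real.log (1 - a) := by
    rw [hc, Finset.sum_mul, ← Finset.sum_add_distrib]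
    refine Finset.sum_congr rfl fun ω _ => ?_
    split
    · rw [Real.log_mul (hf ω).ne' (by linarith)]
      ring
    · simp
  have e₂ : ∑ ω, (f ω * if S ω then 1 - a else 1) = Z * (1 - a * (q / Z)) := by
    rw [mul_sub, mul_one, mul_left_comm, mul_div_cancel₀ _ hZ0.ne', hZ, hq, Finset.mul_sum,
      ← Finset.sum_sub_distrib]
    refine Finset.sum_congr rfl fun ω _ => ?_
    split <;> ring
  have hq1 : q / Z ≤ 1 := (div_le_one hZ0).2 hqZ
  have hpos : 0 < 1 - a * (q / Z) := by nlinarith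
  have h₂ := Real.log_le_sub_one_of_pos hpos
  have h₃ := mul_le_mul_of_nonneg_left (neg_sub_two_sq_le_log_one_sub h₁) hc0
  rw [logLik, logLik, e₁, e₂, Real.log_mul hZ0.ne' hpos.ne', ← hZ]
  linarith

/-- One update with a random direction: the points `ω` and `ω'` are drawn from `b` and from `f`,
and a potential that drops by the two stated amounts drops on average by `a` times the square
of the gap. -/
lemma average_update_le {Ω : Type} [Fintype Ω] {b f : Ω → ℝ} (hb : ∀ ω, 0 ≤ b ω)
    (hb1 : ∑ ω, b ω = 1) (hf : ∀ ω, 0 ≤ f ω) (hZ : 0 < ∑ ω, f ω) (R : Ω → Bool)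
    {a Φ Y₁ Y₂ β q : ℝ} (hβ : β = ∑ ω, if R ω then b ω else 0)
    (hq : q = (∑ ω, if R ω then f ω else 0) / ∑ ω, f ω)
    (h₁ : Y₁ ≤ Φ - a * (β - q) + 2 * a ^ 2 * (1 - β))
    (h₂ : Y₂ ≤ Φ + a * (β - q) + 2 * a ^ 2 * β) :
    ∑ ω', f ω' * ∑ ω, b ω * (if R ω then (if R ω' then Φ else Y₁) else (if R ω' then Y₂ else Φ))
      ≤ (∑ ω, f ω) * (Φ + 2 * a ^ 2 - a * (β - q) ^ 2) := by
  have hq' : q * ∑ ω, f ω = ∑ ω, if R ω then f ω else 0 := by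
    rw [hq, div_mul_cancel₀ _ hZ.ne']
  have hβ0 : 0 ≤ β := hβ ▸ Finset.sum_nonneg fun ω _ => by split <;> simp [hb ω]
  have hβ1 : β ≤ 1 := by
    rw [hβ, ← hb1]
    exact Finset.sum_le_sum fun ω _ => by split <;> simp [hb ω]
  have hq0 : 0 ≤ q := hq ▸ div_nonneg
    (Finset.sum_nonneg fun ω _ => by split <;> simp [hf ω]) hZ.le
  have hq1 : q ≤ 1 := by
    rw [hq, div_le_one hZ]
    exact Finset.sum_le_sum fun ω _ => by split <;> simp [hf ω]
  have inner : ∀ x y : ℝ, ∑ ω, b ω * (if R ω then x else y) = β * x + (1 - β) * y := by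
    intro x y
    have : ∀ ω, b ω * (if R ω then x else y)
        = (if R ω then b ω else 0) * x + (b ω - if R ω then b ω else 0) * y := by
      intro ω
      split <;> ring
    simp only [this, Finset.sum_add_distrib, ← Finset.sum_mul, Finset.sum_sub_distrib, hb1, ← hβ]
  have outer : ∀ x y : ℝ, ∑ ω, f ω * (if R ω then x else y)
      = (∑ ω, f ω) * (q * x + (1 - q) * y) := by
    intro x y
    have : ∀ ω, f ω * (if R ω then x else y)
        = (if R ω then f ω else 0) * x + (f ω - if R ω then f ω else 0) * y := by
      intro ω
      split <;> ring
    simp only [this, Finset.sum_add_distrib, ← Finset.sum_mul, Finset.sum_sub_distrib, ← hq']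
    ring
  have key : ∀ ω', ∑ ω, b ω *
      (if R ω then (if R ω' then Φ else Y₁) else (if R ω' then Y₂ else Φ))
      = if R ω' then β * Φ + (1 - β) * Y₂ else β * Y₁ + (1 - β) * Φ := by
    intro ω'
    rw [inner]
    split <;> rfl
  simp only [key, outer]
  refine mul_le_mul_of_nonneg_left ?_ hZ.le
  -- The two updates have probabilities β(1 - q) and q(1 - β). Their difference is β - q, so the
  -- first-order terms combine to -a(β - q)²; the second-order ones add up to 2a²β(1 - β).
  have k₁ := mul_le_mul_of_nonneg_left h₁ (mul_nonneg hβ0 (sub_nonneg.2 hq1))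
  have k₂ := mul_le_mul_of_nonneg_left h₂ (mul_nonneg hq0 (sub_nonneg.2 hβ1))
  have k₃ : 2 * a ^ 2 * (β * (1 - q) * (1 - β) + q * (1 - β) * β) ≤ 2 * a ^ 2 * 1 := by
    refine mul_le_mul_of_nonneg_left ?_ (by positivity)
    have : β * (1 - q) * (1 - β) + q * (1 - β) * β = β * (1 - β) := by ring
    rw [this]
    nlinarith
  nlinarith

/-- The left side is the b-average of log(f · |Ω| / Z), and log x ≤ x. -/
lemma logLik_add_log_card_le {Ω : Type} [Fintype Ω] [Nonempty Ω] {b f : Ω → ℝ}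
    (hb : ∀ ω, 0 ≤ b ω) (hb1 : ∑ ω, b ω = 1) (hf : ∀ ω, 0 < f ω) {D : ℝ}
    (h : ∑ ω, b ω * f ω ≤ D * ((∑ ω, f ω) / Fintype.card Ω)) :
    logLik b f + Real.log (Fintype.card Ω) ≤ D := by
  have hZ0 : 0 < ∑ ω, f ω := Finset.sum_pos (fun ω _ => hf ω) Finset.univ_nonempty
  have hc : (0 : ℝ) < Fintype.card Ω := by exact_mod_cast Fintype.card_pos
  set Z := ∑ ω, f ω with hZ
  set c : ℝ := ((Fintype.card Ω : ℕ) : ℝ)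
  have e : logLik b f + Real.log c = ∑ ω, b ω * Real.log (f ω * (c / Z)) := by
    have : ∀ ω, b ω * Real.log (f ω * (c / Z))
        = b ω * Real.log (f ω) + b ω * (Real.log c - Real.log Z) := by
      intro ω
      rw [Real.log_mul (hf ω).ne' (by positivity), Real.log_div hc.ne' hZ0.ne']
      ring
    simp only [this, Finset.sum_add_distrib, ← Finset.sum_mul, hb1, logLik, ← hZ]
    ring
  rw [e]
  calc ∑ ω, b ω * Real.log (f ω * (c / Z)) ≤ ∑ ω, b ω * (f ω * (c / Z)) := by
        refine Finset.sum_le_sum fun ω _ => mul_le_mul_of_nonneg_left ?_ (hb ω)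
        have := Real.log_le_sub_one_of_pos (mul_pos (hf ω) (div_pos hc hZ0))
        linarith
    _ = (∑ ω, b ω * f ω) * (c / Z) := by
        rw [Finset.sum_mul]
        exact Finset.sum_congr rfl fun ω _ => (mul_assoc _ _ _).symm
    _ ≤ D * (Z / c) * (c / Z) := mul_le_mul_of_nonneg_right h (by positivity)
    _ = D := by field_simp

/-! ### Upper uniformity -/

/-- Among the bipartitions `(A, Aᶜ)` there is one that cuts a quarter of the edges between `U`
and `V`. -/
lemma exists_bipartition {N : ℕ} (G : Digraph (Fin N)) (hG : ∀ v, ¬ G.Adj v v)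
    (U V : Finset (Fin N)) : ∃ A : Finset (Fin N),
      (edgesBetween G U V).card ≤ 4 * (edgesBetween G (U ∩ A) (V \ A)).card := by
  classical
  -- Averaging over all A: an edge that is not a loop starts in A and ends outside A for a quarter
  -- of the sets A.
  by_contra! hcon
  have h₁ : ∑ A : Finset (Fin N), (edgesBetween G (U ∩ A) (V \ A)).card
      = ∑ e ∈ edgesBetween G U V,
        (Finset.univ.filter fun A : Finset (Fin N) => e.1 ∈ A ∧ e.2 ∉ A).card := by
    have : ∀ A : Finset (Fin N), edgesBetween G (U ∩ A) (V \ A)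
        = (edgesBetween G U V).filter fun e => e.1 ∈ A ∧ e.2 ∉ A := by
      intro A
      ext e
      simp only [edgesBetween, Finset.mem_filter, Finset.mem_product, Finset.mem_inter,
        Finset.mem_sdiff]
      tauto
    simp only [this, Finset.card_filter]
    exact Finset.sum_comm
  have h₂ : ∀ e ∈ edgesBetween G U V,
      Fintype.card (Finset (Fin N)) ≤
      4 * (Finset.univ.filter fun A : Finset (Fin N) => e.1 ∈ A ∧ e.2 ∉ A).card := by
    intro e he
    have hne : e.1 ≠ e.2 := by
      intro h
      have := (Finset.mem_filter.1 he).2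
      rw [h] at this
      exact hG _ this
    set F := Finset.univ.filter fun A : Finset (Fin N) => e.1 ∈ A ∧ e.2 ∉ A with hF
    -- Every A is recovered from a set that cuts `e` and two bits, which say whether to insert `e.2`
    -- and whether to delete `e.1`.
    have hsub : (Finset.univ : Finset (Finset (Fin N))) ⊆
        (F ×ˢ (Finset.univ : Finset (Bool × Bool))).image fun x =>
          (if x.2.1 then insert e.2 x.1 else x.1) \ (if x.2.2 then {e.1} else ∅) := by
      intro A _
      refine Finset.mem_image.2 ⟨(insert e.1 A \ {e.2}, decide (e.2 ∈ A), decide (e.1 ∉ A)),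
        ?_, ?_⟩
      · simp [hF, hne]
      · ext x
        by_cases hx1 : x = e.1 <;> by_cases hx2 : x = e.2 <;> by_cases h1 : e.1 ∈ A <;>
          by_cases h2 : e.2 ∈ A <;> simp_all
    calc Fintype.card (Finset (Fin N)) ≤ _ := Finset.card_le_card hsub
      _ ≤ _ := Finset.card_image_le
      _ = 4 * F.card := by
        rw [Finset.card_product, mul_comm]
        rfl
  have h₃ := Finset.sum_le_sum h₂
  rw [← Finset.mul_sum, ← h₁, Finset.mul_sum, Finset.sum_const, smul_eq_mul] at h₃
  have h₄ : ∑ A : Finset (Fin N), 4 * (edgesBetween G (U ∩ A) (V \ A)).card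
      < ∑ A : Finset (Fin N), (edgesBetween G U V).card :=
    Finset.sum_lt_sum_of_nonempty Finset.univ_nonempty fun A _ => hcon A
  rw [Finset.sum_const, smul_eq_mul, Finset.card_univ, mul_comm] at h₄
  omega

lemma rectProb_eq_sum {N : ℕ} (B : Object N) (U V : Finset (Fin N)) :
    rectProb B U V = ∑ e ∈ U ×ˢ V, (B e).toReal := by
  have : {e : Fin N × Fin N | e.1 ∈ U ∧ e.2 ∈ V} = ((U ×ˢ V : Finset _) : Set (Fin N × Fin N)) := by
    ext e
    simp
  rw [rectProb, prob, this, PMF.toOuterMeasure_apply_finset,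
    ENNReal.toReal_sum fun e _ => B.apply_ne_top e]

/-- The density clause covers large disjoint sets, and the small-set clause produces the additive η.
Overlapping sets are reduced to disjoint ones by a bipartition, whence the factor 4. -/
lemma rectProb_le_of_upperUniform {N : ℕ} {η γ : ℝ} (hη : 0 ≤ η) (hγ : 0 ≤ γ)
    {G : Digraph (Fin N)} (hG : ∀ v, ¬ G.Adj v v) {B : Object N} (hB : IsSupportAccess G B)
    (hU : UpperUniform η γ G) (U V : Finset (Fin N)) :
    ∑ e ∈ U ×ˢ V, (B e).toReal ≤ 4 * γ * ((U ×ˢ V).card / (N : ℝ) ^ 2 + η) := by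
  classical
  obtain ⟨hne, rfl⟩ := hB
  set E := edgesBetween G Finset.univ Finset.univ with hE
  have hE0 : (0 : ℝ) < E.card := by exact_mod_cast hne.card_pos
  have hN : (0 : ℝ) < N := by
    obtain ⟨e, _⟩ := hne
    exact_mod_cast e.1.pos
  have h₁ : ∑ e ∈ U ×ˢ V, (PMF.uniformOfFinset E hne e).toReal
      = (edgesBetween G U V).card / (E.card : ℝ) := by
    have : ∀ e ∈ U ×ˢ V, (PMF.uniformOfFinset E hne e).toReal
        = if G.Adj e.1 e.2 then (E.card : ℝ)⁻¹ else 0 := by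
      intro e _
      have : e ∈ E ↔ G.Adj e.1 e.2 := by simp [hE, edgesBetween]
      by_cases h : G.Adj e.1 e.2 <;> simp [PMF.uniformOfFinset_apply, this, h]
    rw [Finset.sum_congr rfl this, ← Finset.sum_filter, Finset.sum_const, nsmul_eq_mul,
      div_eq_mul_inv, edgesBetween]
  have hρ : density G Finset.univ Finset.univ * (N : ℝ) ^ 2 = E.card := by
    rw [density, ← hE, Finset.card_univ, Fintype.card_fin]
    field_simp
  have hcut : ∀ U V : Finset (Fin N), Disjoint U V → ((edgesBetween G U V).card : ℝ)
      ≤ γ * (U.card * V.card / (N : ℝ) ^ 2 + η) * E.card := by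
    intro U V hd
    by_cases h : η * N ≤ min (U.card : ℝ) (V.card : ℝ)
    · have h₂ := hU.1 U V hd h
      -- With an empty side the density is a division by zero and says nothing, but then there are
      -- no edges.
      by_cases h0 : (U.card : ℝ) * V.card = 0
      · have : edgesBetween G U V = ∅ := by
          rcases mul_eq_zero.1 h0 with h0 | h0 <;>
            simp [edgesBetween, Finset.card_eq_zero.1 (Nat.cast_eq_zero.1 h0)]
        rw [this]
        simp only [Finset.card_empty, Nat.cast_zero]
        positivity
      · have hpos : (0 : ℝ) < U.card * V.card := lt_of_le_of_ne (by positivity) (Ne.symm h0)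
        rw [density, div_le_iff₀ hpos] at h₂
        refine h₂.trans ?_
        rw [← hρ]
        have hd0 : 0 ≤ density G Finset.univ Finset.univ := by
          unfold density
          positivity
        have : γ * (U.card * V.card / (N : ℝ) ^ 2 + η)
              * (density G Finset.univ Finset.univ * (N : ℝ) ^ 2)
            = γ * density G Finset.univ Finset.univ * (U.card * V.card)
              + γ * η * (density G Finset.univ Finset.univ * (N : ℝ) ^ 2) := by
          field_simp
        rw [this]
        have : 0 ≤ γ * η * (density G Finset.univ Finset.univ * (N : ℝ) ^ 2) := by positivity
        linarith
    · have h₂ := hU.2 U V (not_le.1 h)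
      refine h₂.trans ?_
      rw [mul_assoc (γ * η), hρ]
      refine mul_le_mul_of_nonneg_right (mul_le_mul_of_nonneg_left ?_ hγ) hE0.le
      have : (0 : ℝ) ≤ U.card * V.card / (N : ℝ) ^ 2 := by positivity
      linarith
  obtain ⟨A, hA⟩ := exists_bipartition G hG U V
  have h₂ := hcut (U ∩ A) (V \ A)
    (Finset.disjoint_of_subset_left Finset.inter_subset_right Finset.disjoint_sdiff)
  rw [h₁, div_le_iff₀ hE0]
  calc ((edgesBetween G U V).card : ℝ) ≤ 4 * (edgesBetween G (U ∩ A) (V \ A)).card := by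
        exact_mod_cast hA
    _ ≤ 4 * (γ * ((U ∩ A).card * (V \ A).card / (N : ℝ) ^ 2 + η) * E.card) := by linarith
    _ ≤ 4 * (γ * (U.card * V.card / (N : ℝ) ^ 2 + η) * E.card) := by
        gcongr
        · exact Finset.inter_subset_left
        · exact Finset.sdiff_subset
    _ = _ := by
        rw [Finset.card_product]
        push_cast
        ring

/-- On every rectangle, the `b`-average of `f` is at most `D` times its average over all pairs,
up to an error. -/
def DominatedOnRects {N : ℕ} (b f : Fin N × Fin N → ℝ) (D ξ : ℝ) : Prop :=
  ∀ U V : Finset (Fin N), ∑ e ∈ U ×ˢ V, b e * f e ≤ D * ((∑ e ∈ U ×ˢ V, f e) / (N : ℝ) ^ 2 + ξ)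

lemma sum_product_split {N : ℕ} (g : Fin N × Fin N → ℝ) (U V U' V' : Finset (Fin N)) :
    ∑ e ∈ U ×ˢ V, g e = ∑ e ∈ (U \ U') ×ˢ V, g e + ∑ e ∈ (U ∩ U') ×ˢ (V \ V'), g e
      + ∑ e ∈ (U ∩ U') ×ˢ (V ∩ V'), g e := by
  simp only [Finset.sum_product]
  have h₁ : ∀ u, ∑ v ∈ V \ V', g (u, v) + ∑ v ∈ V ∩ V', g (u, v) = ∑ v ∈ V, g (u, v) := by
    intro u
    rw [add_comm, Finset.sum_inter_add_sum_sdiff]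
  rw [add_assoc, ← Finset.sum_add_distrib, Finset.sum_congr rfl fun u _ => h₁ u, add_comm,
    Finset.sum_inter_add_sum_sdiff]

/-- The new function is (1 - a) f plus a times f restricted to the region that agrees with `d`.
Inside U × V this region is one rectangle, or the complement of one, which splits into two
rectangles. The errors add up to at most (1 - a)ξ + 2aξ ≤ 2ξ. -/
lemma DominatedOnRects.penalize {N : ℕ} {b f : Fin N × Fin N → ℝ} {D ξ a : ℝ}
    (h : DominatedOnRects b f D ξ) (hD : 0 ≤ D) (hξ : 0 ≤ ξ) (h₀ : 0 ≤ a) (h₁ : a ≤ 1)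
    (U' V' : Finset (Fin N)) (d : Bool) :
    DominatedOnRects b (fun e => f e * if decide (e.1 ∈ U' ∧ e.2 ∈ V') = d then 1 else 1 - a)
      D (2 * ξ) := by
  have hsum : ∀ g : Fin N × Fin N → ℝ, ∀ U V : Finset (Fin N),
      ∑ e ∈ U ×ˢ V, (g e * if decide (e.1 ∈ U' ∧ e.2 ∈ V') = d then 1 else 1 - a)
        = (1 - a) * ∑ e ∈ U ×ˢ V, g e + a * if d = true
          then ∑ e ∈ (U ∩ U') ×ˢ (V ∩ V'), g e
          else ∑ e ∈ (U \ U') ×ˢ V, g e + ∑ e ∈ (U ∩ U') ×ˢ (V \ V'), g e := by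
    intro g U V
    have c₁ : ∑ e ∈ (U \ U') ×ˢ V, (g e * if decide (e.1 ∈ U' ∧ e.2 ∈ V') = d then 1 else 1 - a)
        = ∑ e ∈ (U \ U') ×ˢ V, g e * if d then 1 - a else 1 := by
      refine Finset.sum_congr rfl fun e he => ?_
      have : e.1 ∉ U' := (Finset.mem_sdiff.1 (Finset.mem_product.1 he).1).2
      cases d <;> simp [this]
    have c₂ : ∑ e ∈ (U ∩ U') ×ˢ (V \ V'),
          (g e * if decide (e.1 ∈ U' ∧ e.2 ∈ V') = d then 1 else 1 - a)
        = ∑ e ∈ (U ∩ U') ×ˢ (V \ V'), g e * if d then 1 - a else 1 := by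
      refine Finset.sum_congr rfl fun e he => ?_
      have : e.2 ∉ V' := (Finset.mem_sdiff.1 (Finset.mem_product.1 he).2).2
      cases d <;> simp [this]
    have c₃ : ∑ e ∈ (U ∩ U') ×ˢ (V ∩ V'),
          (g e * if decide (e.1 ∈ U' ∧ e.2 ∈ V') = d then 1 else 1 - a)
        = ∑ e ∈ (U ∩ U') ×ˢ (V ∩ V'), g e * if d then 1 else 1 - a := by
      refine Finset.sum_congr rfl fun e he => ?_
      have h₁ : e.1 ∈ U' := (Finset.mem_inter.1 (Finset.mem_product.1 he).1).2
      have h₂ : e.2 ∈ V' := (Finset.mem_inter.1 (Finset.mem_product.1 he).2).2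
      cases d <;> simp [h₁, h₂]
    rw [sum_product_split _ U V U' V', c₁, c₂, c₃, ← Finset.sum_mul, ← Finset.sum_mul,
      ← Finset.sum_mul, sum_product_split g U V U' V']
    cases d <;> simp <;> ring
  intro U V
  have hassoc : ∀ e : Fin N × Fin N,
      b e * (f e * if decide (e.1 ∈ U' ∧ e.2 ∈ V') = d then 1 else 1 - a)
        = (b e * f e) * if decide (e.1 ∈ U' ∧ e.2 ∈ V') = d then 1 else 1 - a :=
    fun e => (mul_assoc _ _ _).symm
  simp only [hassoc]
  rw [hsum (fun e => b e * f e), hsum f]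
  have k := mul_le_mul_of_nonneg_left (h U V) (sub_nonneg.2 h₁)
  have hslack : 0 ≤ D * ξ * (1 - a) := mul_nonneg (mul_nonneg hD hξ) (sub_nonneg.2 h₁)
  have hslack' : 0 ≤ D * ξ * a := mul_nonneg (mul_nonneg hD hξ) h₀
  cases d
  · have k₁ := mul_le_mul_of_nonneg_left (h (U \ U') V) h₀
    have k₂ := mul_le_mul_of_nonneg_left (h (U ∩ U') (V \ V')) h₀
    simp only [Bool.false_eq_true, if_false]
    ring_nf at k k₁ k₂ hslack hslack' ⊢
    linarith
  · have k₁ := mul_le_mul_of_nonneg_left (h (U ∩ U') (V ∩ V')) h₀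
    simp only [if_true]
    ring_nf at k k₁ hslack hslack' ⊢
    linarith

/-! ### Mixtures -/

/-- The mixture of `S` and `F` with weights `w` and `1 - w`. -/
def mix (w : ℝ) (S F : ℝ≥0∞) : ℝ≥0∞ := ENNReal.ofReal w * S + ENNReal.ofReal (1 - w) * F

lemma mix_one (S F : ℝ≥0∞) : mix 1 S F = S := by simp [mix]

lemma mix_zero (S F : ℝ≥0∞) : mix 0 S F = F := by simp [mix]

lemma mix_mix {w x : ℝ} (hw₁ : w ≤ 1) (hx₀ : 0 ≤ x) (hx₁ : x ≤ 1) (S F : ℝ≥0∞) :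
    mix x (mix w S F) F = mix (w * x) S F := by
  unfold mix
  rw [mul_add, ← mul_assoc, ← mul_assoc, ← ENNReal.ofReal_mul hx₀, ← ENNReal.ofReal_mul hx₀,
    add_assoc, ← add_mul, ← ENNReal.ofReal_add (mul_nonneg hx₀ (by linarith)) (by linarith)]
  congr 3 <;> ring_nf

lemma half_mix {w : ℝ} (hw₀ : 0 ≤ w) (S F : ℝ≥0∞) :
    2⁻¹ * mix w S F + 2⁻¹ * S = mix ((w + 1) / 2) S F := by
  have h : (2⁻¹ : ℝ≥0∞) = ENNReal.ofReal (1 / 2) := by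
    rw [one_div, ENNReal.ofReal_inv_of_pos two_pos]
    simp
  unfold mix
  rw [h, mul_add, ← mul_assoc, ← mul_assoc, ← ENNReal.ofReal_mul (by norm_num),
    ← ENNReal.ofReal_mul (by norm_num), add_right_comm, ← add_mul,
    ← ENNReal.ofReal_add (by linarith) (by norm_num)]
  congr 3 <;> ring

/-! ### Weights -/

/-- Is the pair `e` in the rectangle of the circuits in register `s`? -/
def hit {N : ℕ} (cs : List (Circuit × Circuit)) (s : ℕ) (e : Fin N × Fin N) : Bool :=
  (memTest cs [e.1] false s 0).1 && (memTest cs [e.2] true s 0).1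

/-- The weight of a pair: every entry `(s, d)` of `l` such that membership in the rectangle `s`
does not agree with `d` costs a factor `1 - 2⁻ᵏ`. -/
def weight {N : ℕ} (k : ℕ) (cs : List (Circuit × Circuit)) (e : Fin N × Fin N) :
    List (ℕ × Bool) → ℝ
  | [] => 1
  | x :: l => weight k cs e l * if hit cs x.1 e = x.2 then 1 else 1 - (1 / 2 : ℝ) ^ k

/-- The average weight. -/
def meanWeight (N k : ℕ) (cs : List (Circuit × Circuit)) (l : List (ℕ × Bool)) : ℝ :=
  (∑ e : Fin N × Fin N, weight k cs e l) / (N : ℝ) ^ 2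

lemma memTest_congr {N : ℕ} (cs : List (Circuit × Circuit)) {vs vs' : List (Fin N)} (side : Bool)
    (s : ℕ) {i j : ℕ} (h : vs[i]? = vs'[j]?) :
    memTest cs vs side s i = memTest cs vs' side s j := by
  unfold memTest
  rw [h]

lemma hit_eq {N : ℕ} (cs : List (Circuit × Circuit)) (s : ℕ) (e : Fin N × Fin N)
    {vs : List (Fin N)} {i j : ℕ} (hi : vs[i]? = some e.1) (hj : vs[j]? = some e.2) :
    hit cs s e = ((memTest cs vs false s i).1 && (memTest cs vs true s j).1) := by
  rw [hit, memTest_congr cs (vs := vs) (vs' := [e.1]) (j := 0) false s (by simpa using hi),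
    memTest_congr cs (vs := vs) (vs' := [e.2]) (j := 0) true s (by simpa using hj)]

lemma half_pow_nonneg (k : ℕ) : 0 ≤ 1 - (1 / 2 : ℝ) ^ k :=
  sub_nonneg.2 (pow_le_one₀ (by norm_num) (by norm_num))

lemma half_pow_le_one (k : ℕ) : 1 - (1 / 2 : ℝ) ^ k ≤ 1 := by
  have : (0 : ℝ) ≤ (1 / 2) ^ k := by positivity
  linarith

lemma weight_nonneg {N : ℕ} (k : ℕ) (cs : List (Circuit × Circuit)) (e : Fin N × Fin N)
    (l : List (ℕ × Bool)) : 0 ≤ weight k cs e l := by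
  induction l with
  | nil => exact zero_le_one
  | cons x l ih =>
    refine mul_nonneg ih ?_
    split
    exacts [zero_le_one, half_pow_nonneg k]

lemma weight_le_one {N : ℕ} (k : ℕ) (cs : List (Circuit × Circuit)) (e : Fin N × Fin N)
    (l : List (ℕ × Bool)) : weight k cs e l ≤ 1 := by
  induction l with
  | nil => exact le_rfl
  | cons x l ih =>
    refine mul_le_one₀ ih ?_ ?_ <;> split
    exacts [zero_le_one, half_pow_nonneg k, le_rfl, half_pow_le_one k]

lemma half_pow_length_le_weight {N : ℕ} {k : ℕ} (hk : 1 ≤ k) (cs : List (Circuit × Circuit))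
    (e : Fin N × Fin N) (l : List (ℕ × Bool)) : (1 / 2 : ℝ) ^ l.length ≤ weight k cs e l := by
  induction l with
  | nil => simp [weight]
  | cons x l ih =>
    rw [List.length_cons, pow_succ]
    refine mul_le_mul ih ?_ (by norm_num) (weight_nonneg _ _ _ _)
    split
    · norm_num
    · have : (1 / 2 : ℝ) ^ k ≤ (1 / 2) ^ 1 := pow_le_pow_of_le_one (by norm_num) (by norm_num) hk
      linarith

/-- Circuit registers are append-only, so the auditor's new answer leaves the current weight, and
hence the potential, unchanged. -/
lemma weight_append {N : ℕ} (k : ℕ) (cs : List (Circuit × Circuit)) (c : Circuit × Circuit)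
    (e : Fin N × Fin N) (l : List (ℕ × Bool)) (hl : ∀ x ∈ l, x.1 < cs.length) :
    weight k (cs ++ [c]) e l = weight k cs e l := by
  induction l with
  | nil => rfl
  | cons x l ih =>
    have hx : hit (cs ++ [c]) x.1 e = hit cs x.1 e := by
      have : (cs ++ [c])[x.1]? = cs[x.1]? := List.getElem?_append_left (hl x (by simp))
      simp only [hit, memTest, this]
    rw [weight, weight, ih fun y hy => hl y (by simp [hy]), hx]

lemma hit_append_length {N : ℕ} (cs : List (Circuit × Circuit)) (c : Circuit × Circuit)
    (e : Fin N × Fin N) :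
    hit (cs ++ [c]) cs.length e = decide (e.1 ∈ c.1.toSet N ∧ e.2 ∈ c.2.toSet N) := by
  simp [hit, memTest, Circuit.toSet]

lemma dominatedOnRects_weight {N : ℕ} {b : Fin N × Fin N → ℝ} {D ξ : ℝ} (hD : 0 ≤ D)
    (hξ : 0 ≤ ξ) (h : DominatedOnRects b (fun _ => 1) D ξ) (k : ℕ)
    (cs : List (Circuit × Circuit)) (l : List (ℕ × Bool)) :
    DominatedOnRects b (fun e => weight k cs e l) D (2 ^ l.length * ξ) := by
  induction l with
  | nil => simpa [weight] using h
  | cons x l ih =>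
    have := ih.penalize hD (by positivity) (a := (1 / 2) ^ k) (by positivity)
      (pow_le_one₀ (by norm_num) (by norm_num))
      (Finset.univ.filter fun u => (memTest cs [u] false x.1 0).1 = true)
      (Finset.univ.filter fun u => (memTest cs [u] true x.1 0).1 = true) x.2
    convert this using 1
    · ext e
      simp [weight, hit]
    · rw [List.length_cons, pow_succ]
      ring

/-! ### The code of the predictor -/

/-- The factor `1 - 2⁻ᵏ` as a rational number. -/
def keepRat (k : ℕ) : Set.Icc (0 : ℚ) 1 :=
  ⟨1 - (1 / 2) ^ k, sub_nonneg.2 (pow_le_one₀ (by norm_num) (by norm_num)),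
    sub_le_self _ (by positivity)⟩

/-- The code of the predictor `q` times the weight. -/
def predCode (k : ℕ) : List (ℕ × Bool) → Set.Icc (0 : ℚ) 1 → PredCode
  | [], q => .val q
  | x :: l, q =>
      let yes := predCode k l (if x.2 then q else q * keepRat k)
      let no := predCode k l (if x.2 then q * keepRat k else q)
      .test false x.1 0 (.test true x.1 1 yes no) no

lemma eval_predCode {N : ℕ} (k : ℕ) (cs : List (Circuit × Circuit)) (e : Fin N × Fin N)
    (l : List (ℕ × Bool)) : ∀ q : Set.Icc (0 : ℚ) 1,
      ((predCode k l q).eval cs e.1 e.2).1 = ((q : ℚ) : ℝ) * weight k cs e l := by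
  induction l with
  | nil =>
    intro q
    simp [predCode, PredCode.eval, weight]
  | cons x l ih =>
    intro q
    have hk : ((keepRat k : ℚ) : ℝ) = 1 - (1 / 2) ^ k := by simp [keepRat]
    have hit' := hit_eq cs x.1 e (vs := [e.1, e.2]) (i := 0) (j := 1) rfl rfl
    simp only [predCode, PredCode.eval, weight, hit']
    obtain ⟨s, d⟩ := x
    cases d <;> cases (memTest cs [e.1, e.2] false s 0).1 <;>
      cases (memTest cs [e.1, e.2] true s 1).1 <;>
      simp [ih, hk] <;> ring

/-! ### The sampler -/

/-- Flip `k` coins, and go to `fail` if all of them show heads. -/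
def SamplerCode.coins (fail succ : SamplerCode) : ℕ → SamplerCode
  | 0 => fail
  | k + 1 => .coin (coins fail succ k) succ

/-- Is the pair in the registers `i`, `j` in the rectangle of register `s`? -/
def SamplerCode.ifHit (s i j : ℕ) (yes no : SamplerCode) : SamplerCode :=
  .test false s i (.test true s j yes no) no

/-- Accept the pair in the registers `0`, `1` with probability given by its weight, and restart
otherwise. -/
def SamplerCode.gate (k : ℕ) (succ : SamplerCode) : List (ℕ × Bool) → SamplerCode
  | [] => succ
  | x :: l =>
      .ifHit x.1 0 1 (if x.2 then gate k succ l else .coins .restart (gate k succ l) k)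
        (if x.2 then .coins .restart (gate k succ l) k else gate k succ l)

/-- Rejection sampling of the distribution proportional to the weight. -/
def samplerCode (k : ℕ) (l : List (ℕ × Bool)) : SamplerCode :=
  .vertex (.vertex (.gate k (.output 0 1) l))

section Sampler

variable {N : ℕ} (cs : List (Circuit × Circuit)) (r : ℕ → Bool) (vs : List (Fin N))
  (h : Option (Fin N × Fin N) → ℝ≥0∞)

lemma expect_coins (fail succ : SamplerCode) (k : ℕ) :
    expect ((SamplerCode.coins fail succ k).pass cs r vs) h
      = mix (1 - (1 / 2) ^ k) (expect (succ.pass cs r vs) h) (expect (fail.pass cs r vs) h) := by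
  induction k with
  | zero => simp [SamplerCode.coins, mix_zero]
  | succ k ih =>
    rw [SamplerCode.coins, SamplerCode.pass, expect_addTime, expect_fairCoin]
    simp only [if_true, Bool.false_eq_true, if_false]
    rw [ih, half_mix (half_pow_nonneg k)]
    congr 1
    rw [pow_succ]
    ring

lemma expect_ifHit (s i j : ℕ) (yes no : SamplerCode) (e : Fin N × Fin N)
    (hi : vs[i]? = some e.1) (hj : vs[j]? = some e.2) :
    expect ((SamplerCode.ifHit s i j yes no).pass cs r vs) h
      = if hit cs s e then expect (yes.pass cs r vs) h else expect (no.pass cs r vs) h := by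
  rw [hit_eq cs s e hi hj]
  simp only [SamplerCode.ifHit, SamplerCode.pass, expect_addTime]
  cases (memTest cs vs false s i).1 <;> cases (memTest cs vs true s j).1 <;>
    simp [expect_addTime]

/-- Each disagreeing update is survived independently with probability 1 - 2⁻ᵏ, which k fair coins
realise exactly; the product over the updates is the weight. -/
lemma expect_gate (k : ℕ) (succ : SamplerCode) (l : List (ℕ × Bool)) (e : Fin N × Fin N) :
    expect ((SamplerCode.gate k succ l).pass cs r [e.1, e.2]) h
      = mix (weight k cs e l) (expect (succ.pass cs r [e.1, e.2]) h) (h none) := by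
  induction l with
  | nil => simp [SamplerCode.gate, weight, mix_one]
  | cons x l ih =>
    rw [SamplerCode.gate, expect_ifHit cs r _ h x.1 0 1 _ _ e rfl rfl, weight]
    have hr : expect (SamplerCode.restart.pass cs r [e.1, e.2]) h = h none := expect_pure _ _ _
    have hc : expect ((SamplerCode.coins .restart (SamplerCode.gate k succ l) k).pass cs r
        [e.1, e.2]) h = mix (weight k cs e l * (1 - (1 / 2) ^ k))
          (expect (succ.pass cs r [e.1, e.2]) h) (h none) := by
      rw [expect_coins, ih, hr, mix_mix (weight_le_one _ _ _ _)
        (half_pow_nonneg k) (half_pow_le_one k)]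
    obtain ⟨s, d⟩ := x
    cases d <;> cases hit cs s e <;> simp [ih, hc]

end Sampler

lemma ofReal_inv_sq {N : ℕ} (hN : 0 < N) :
    ((N : ℝ≥0∞)⁻¹ * (N : ℝ≥0∞)⁻¹) = ENNReal.ofReal (((N : ℝ) ^ 2)⁻¹) := by
  rw [ENNReal.ofReal_inv_of_pos (by positivity), ENNReal.ofReal_pow (by positivity),
    ENNReal.ofReal_natCast, sq, ENNReal.mul_inv (by simp) (by simp)]

/-- Drawing a uniform pair and accepting it with probability given by the weight. -/
lemma sum_uniform_mix {N : ℕ} (hN : 0 < N) (k : ℕ) (cs : List (Circuit × Circuit))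
    (l : List (ℕ × Bool)) (g : Fin N × Fin N → ℝ≥0∞) (F : ℝ≥0∞) :
    ∑ u : Fin N, (N : ℝ≥0∞)⁻¹ * ∑ v : Fin N, (N : ℝ≥0∞)⁻¹ * mix (weight k cs (u, v) l) (g (u, v)) F
      = ∑ e, ENNReal.ofReal (weight k cs e l / (N : ℝ) ^ 2) * g e
        + ENNReal.ofReal (1 - meanWeight N k cs l) * F := by
  have hN' : (0 : ℝ) < N := by exact_mod_cast hN
  have h₁ : ∀ e : Fin N × Fin N, 0 ≤ (1 - weight k cs e l) / (N : ℝ) ^ 2 := fun e =>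
    div_nonneg (sub_nonneg.2 (weight_le_one _ _ _ _)) (by positivity)
  have h₂ : 1 - meanWeight N k cs l
      = ∑ e : Fin N × Fin N, (1 - weight k cs e l) / (N : ℝ) ^ 2 := by
    rw [← Finset.sum_div, Finset.sum_sub_distrib, sub_div, meanWeight]
    congr 1
    simp only [Finset.sum_const, Finset.card_univ, Fintype.card_prod, Fintype.card_fin,
      nsmul_eq_mul, mul_one, Nat.cast_mul]
    field_simp
  rw [h₂, ENNReal.ofReal_sum_of_nonneg fun e _ => h₁ e, Finset.sum_mul, ← Finset.sum_add_distrib,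
    Fintype.sum_prod_type]
  refine Finset.sum_congr rfl fun u _ => ?_
  rw [Finset.mul_sum]
  refine Finset.sum_congr rfl fun v _ => ?_
  rw [← mul_assoc, ofReal_inv_sq hN, mix, mul_add, ← mul_assoc, ← mul_assoc,
    ← ENNReal.ofReal_mul (by positivity), ← ENNReal.ofReal_mul (by positivity)]
  congr 3 <;> ring

lemma expect_samplerCode {N : ℕ} (hN : 0 < N) (k : ℕ) (cs : List (Circuit × Circuit))
    (l : List (ℕ × Bool)) (r : ℕ → Bool) (h : Option (Fin N × Fin N) → ℝ≥0∞) :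
    expect ((samplerCode k l).pass cs r []) h
      = ∑ e, ENNReal.ofReal (weight k cs e l / (N : ℝ) ^ 2) * h (some e)
        + ENNReal.ofReal (1 - meanWeight N k cs l) * h none := by
  have : Nonempty (Fin N) := ⟨⟨0, hN⟩⟩
  rw [← sum_uniform_mix hN k cs l (fun e => h (some e)) (h none)]
  simp only [samplerCode, SamplerCode.pass, this, dif_pos, expect_addTime, expect_bind,
    tsum_fintype, PMF.uniformOfFintype_apply, Fintype.card_fin, List.nil_append,
    List.singleton_append]
  refine Finset.sum_congr rfl fun u _ => ?_
  congr 1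
  refine Finset.sum_congr rfl fun v _ => ?_
  rw [expect_gate cs r h k _ l (u, v)]
  congr 2
  exact expect_pure _ _ _

/-! ### The learner -/

/-- Flip `k` coins, and go to `fail` if all of them show heads. -/
def Learner.coins (fail succ : Learner) : ℕ → Learner
  | 0 => fail
  | k + 1 => .coin (coins fail succ k) succ

/-- Is the pair in the registers `i`, `j` in the rectangle of register `s`? -/
def Learner.ifHit (s i j : ℕ) (yes no : Learner) : Learner :=
  .test false s i (.test true s j yes no) no

/-- Accept the pair in the registers `i`, `i + 1` with probability given by its weight. -/
def Learner.gate (k i : ℕ) (fail succ : Learner) : List (ℕ × Bool) → Learner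
  | [] => succ
  | x :: l =>
      .ifHit x.1 i (i + 1)
        (if x.2 then gate k i fail succ l else .coins fail (gate k i fail succ l) k)
        (if x.2 then .coins fail (gate k i fail succ l) k else gate k i fail succ l)

/-- Make `K` attempts to draw a pair from the distribution proportional to the weight. The
number `m` is that of the first free vertex register. -/
def Learner.draw (k : ℕ) (l : List (ℕ × Bool)) (fail succ : ℕ → Learner) : ℕ → ℕ → Learner
  | 0, m => fail m
  | K + 1, m => .vertex (.vertex (.gate k m (draw k l fail succ K (m + 2)) (succ m) l))

/-- The update of the weight, given the membership in the rectangle `r` of a pair drawn from the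
object (`x`) and of a pair drawn from the current distribution (`y`). -/
def update (r : ℕ) (l : List (ℕ × Bool)) (x y : Bool) : List (ℕ × Bool) :=
  if x then (if y then l else (r, true) :: l) else (if y then (r, false) :: l else l)

/-- The learner with `n` more rounds. The numbers `r` and `m` are those of the first free circuit
and vertex registers. -/
def Learner.rounds (k K : ℕ) : ℕ → ℕ → ℕ → List (ℕ × Bool) → Learner
  | 0, _, _, l => .output 0 (samplerCode k l)
  | n + 1, r, m, l => .audit (predCode k l 1) (.draw k l (fun i => rounds k K n (r + 1) i l)
      (fun i => .sample (.ifHit r (i + 2) (i + 3)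
        (.ifHit r i (i + 1) (rounds k K n (r + 1) (i + 4) (update r l true true))
          (rounds k K n (r + 1) (i + 4) (update r l true false)))
        (.ifHit r i (i + 1) (rounds k K n (r + 1) (i + 4) (update r l false true))
          (rounds k K n (r + 1) (i + 4) (update r l false false))))) K m)

/-- Run one of `P b, …, P (b + 2ᵐ - 1)`, chosen uniformly. -/
def Learner.pick (P : ℕ → Learner) : ℕ → ℕ → Learner
  | 0, b => P b
  | m + 1, b => .coin (pick P m b) (pick P m (b + 2 ^ m))

section Learner

variable {N : ℕ} (Λ : AuditAlg N) (B : Object N) (h : Implementation → ℝ≥0∞)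

lemma Learner.expect_coins (vs : List (Fin N)) (cs : List (Circuit × Circuit))
    (fail succ : Learner) (k : ℕ) :
    expect ((Learner.coins fail succ k).runFrom Λ B vs cs) h
      = mix (1 - (1 / 2) ^ k) (expect (succ.runFrom Λ B vs cs) h)
        (expect (fail.runFrom Λ B vs cs) h) := by
  induction k with
  | zero => simp [Learner.coins, mix_zero]
  | succ k ih =>
    rw [Learner.coins, Learner.runFrom, expect_addTime, expect_fairCoin]
    simp only [if_true, Bool.false_eq_true, if_false]
    rw [ih, half_mix (half_pow_nonneg k)]
    congr 1
    rw [pow_succ]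
    ring

lemma Learner.expect_ifHit (vs : List (Fin N)) (cs : List (Circuit × Circuit)) (s i j : ℕ)
    (yes no : Learner) (e : Fin N × Fin N) (hi : vs[i]? = some e.1) (hj : vs[j]? = some e.2) :
    expect ((Learner.ifHit s i j yes no).runFrom Λ B vs cs) h
      = if hit cs s e then expect (yes.runFrom Λ B vs cs) h
        else expect (no.runFrom Λ B vs cs) h := by
  rw [hit_eq cs s e hi hj]
  simp only [Learner.ifHit, Learner.runFrom, expect_addTime]
  cases (memTest cs vs false s i).1 <;> cases (memTest cs vs true s j).1 <;>
    simp [expect_addTime]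

lemma Learner.expect_gate (vs : List (Fin N)) (cs : List (Circuit × Circuit)) (k i : ℕ)
    (fail succ : Learner) (l : List (ℕ × Bool)) (e : Fin N × Fin N) (hi : vs[i]? = some e.1)
    (hj : vs[i + 1]? = some e.2) :
    expect ((Learner.gate k i fail succ l).runFrom Λ B vs cs) h
      = mix (weight k cs e l) (expect (succ.runFrom Λ B vs cs) h)
        (expect (fail.runFrom Λ B vs cs) h) := by
  induction l with
  | nil => simp [Learner.gate, weight, mix_one]
  | cons x l ih =>
    rw [Learner.gate, Learner.expect_ifHit Λ B h vs cs x.1 i (i + 1) _ _ e hi hj, weight]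
    have hc : expect ((Learner.coins fail (Learner.gate k i fail succ l) k).runFrom Λ B vs cs) h
        = mix (weight k cs e l * (1 - (1 / 2) ^ k))
          (expect (succ.runFrom Λ B vs cs) h) (expect (fail.runFrom Λ B vs cs) h) := by
      rw [Learner.expect_coins, ih, mix_mix (weight_le_one _ _ _ _)
        (half_pow_nonneg k) (half_pow_le_one k)]
    obtain ⟨s, d⟩ := x
    cases d <;> cases hit cs s e <;> simp [ih, hc]

/-- The value of at most `K` attempts, if an attempt contributes `A` and fails with
probability `ν`, and `x` is the value after `K` failures. -/
def drawValue (A ν x : ℝ≥0∞) : ℕ → ℝ≥0∞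
  | 0 => x
  | K + 1 => A + ν * drawValue A ν x K

/-- Rejected pairs stay in the vertex registers. The continuations are therefore assumed to have
values that depend on the accepted pair only, not on the earlier register contents. -/
lemma Learner.expect_draw (hN : 0 < N) (cs : List (Circuit × Circuit)) (k : ℕ)
    (l : List (ℕ × Bool)) (fail succ : ℕ → Learner) (g : Fin N × Fin N → ℝ≥0∞) (x : ℝ≥0∞)
    (hfail : ∀ vs : List (Fin N), expect ((fail vs.length).runFrom Λ B vs cs) h = x)
    (hsucc : ∀ (vs : List (Fin N)) (e : Fin N × Fin N),
      expect ((succ vs.length).runFrom Λ B (vs ++ [e.1, e.2]) cs) h = g e) (K : ℕ) :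
    ∀ vs : List (Fin N),
      expect ((Learner.draw k l fail succ K vs.length).runFrom Λ B vs cs) h
        = drawValue (∑ e, ENNReal.ofReal (weight k cs e l / (N : ℝ) ^ 2) * g e)
          (ENNReal.ofReal (1 - meanWeight N k cs l)) x K := by
  induction K with
  | zero => exact hfail
  | succ K ih =>
    intro vs
    rw [drawValue, ← sum_uniform_mix hN k cs l g]
    simp only [Learner.draw, Learner.runFrom, expect_addTime, expect_bind,
      tsum_fintype, PMF.uniformOfFintype_apply, Fintype.card_fin, List.append_assoc,
      List.singleton_append]
    refine Finset.sum_congr rfl fun u _ => ?_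
    congr 1
    refine Finset.sum_congr rfl fun v _ => ?_
    rw [Learner.expect_gate Λ B h (vs ++ [u, v]) cs k vs.length _ _ l (u, v) (by simp) (by simp),
      hsucc vs (u, v)]
    have := ih (vs ++ [u, v])
    rw [List.length_append, List.length_cons, List.length_cons, List.length_nil] at this
    rw [this]

/-- The expectation of `ψ` after one round, as a function of the circuits and of the updates so
far. -/
def roundValue (k K : ℕ) (ψ : List (Circuit × Circuit) → List (ℕ × Bool) → ℝ≥0∞)
    (cs : List (Circuit × Circuit)) (l : List (ℕ × Bool)) : ℝ≥0∞ :=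
  expect (Λ.run B (fun u v => weight k cs (u, v) l) fun _ _ => 0) fun c =>
    drawValue (∑ e' : Fin N × Fin N, ENNReal.ofReal (weight k (cs ++ [c]) e' l / (N : ℝ) ^ 2) *
        ∑ e, B e * ψ (cs ++ [c]) (update cs.length l (hit (cs ++ [c]) cs.length e)
          (hit (cs ++ [c]) cs.length e')))
      (ENNReal.ofReal (1 - meanWeight N k (cs ++ [c]) l)) (ψ (cs ++ [c]) l) K

/-- The expectation of `h` at the output of the learner with `n` rounds. -/
def roundsValue (k K : ℕ) : ℕ → List (Circuit × Circuit) → List (ℕ × Bool) → ℝ≥0∞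
  | 0, cs, l => h ⟨0, samplerCode k l, cs⟩
  | n + 1, cs, l => roundValue Λ B k K (roundsValue k K n) cs l

/-- The register numbers written in the code equal the current list lengths, so the tests find the
weight's pair at i, i + 1 and the object's pair at i + 2, i + 3. Once vertices are forgotten, the
program becomes a recursion on circuits and updates alone. -/
lemma Learner.expect_rounds (hN : 0 < N) (k K n : ℕ) :
    ∀ (vs : List (Fin N)) (cs : List (Circuit × Circuit)) (l : List (ℕ × Bool)),
      expect ((Learner.rounds k K n cs.length vs.length l).runFrom Λ B vs cs) h
        = roundsValue Λ B h k K n cs l := by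
  induction n with
  | zero =>
    intro vs cs l
    exact expect_pure _ _ _
  | succ n ih =>
    intro vs cs l
    have hp : (fun u v : Fin N => ((predCode k l 1).eval cs u v).1)
        = fun u v => weight k cs (u, v) l := by
      ext u v
      have := eval_predCode k cs (u, v) l 1
      simpa using this
    rw [Learner.rounds, Learner.runFrom, expect_addTime, expect_bind, roundsValue, roundValue, hp,
      AuditAlg.expect_run B _ (fun _ _ => 0) fun u v => ((predCode k l 1).eval cs u v).2, expect]
    refine tsum_congr fun y => ?_
    congr 1
    rw [expect_addTime]
    have ih' : ∀ (vs : List (Fin N)) (l : List (ℕ × Bool)),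
        expect ((Learner.rounds k K n (cs.length + 1) vs.length l).runFrom Λ B vs
          (cs ++ [y.1])) h = roundsValue Λ B h k K n (cs ++ [y.1]) l := by
      intro vs l
      rw [← ih vs (cs ++ [y.1]) l, List.length_append, List.length_singleton]
    refine Learner.expect_draw Λ B h hN _ k l _ _ _ _ (fun vs => ih' vs l) (fun vs e' => ?_) K vs
    rw [Learner.runFrom, expect_addTime, expect_bind, tsum_fintype]
    refine Finset.sum_congr rfl fun e _ => ?_
    congr 1
    have ih'' : ∀ l : List (ℕ × Bool),
        expect ((Learner.rounds k K n (cs.length + 1) (vs.length + 4) l).runFrom Λ B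
          (vs ++ [e'.1, e'.2] ++ [e.1, e.2]) (cs ++ [y.1])) h
          = roundsValue Λ B h k K n (cs ++ [y.1]) l := by
      intro l
      rw [← ih' (vs ++ [e'.1, e'.2] ++ [e.1, e.2]) l]
      simp
    rw [Learner.expect_ifHit Λ B h _ _ _ _ _ _ _ e (by simp) (by simp),
      Learner.expect_ifHit Λ B h _ _ _ _ _ _ _ e' (by simp) (by simp),
      Learner.expect_ifHit Λ B h _ _ _ _ _ _ _ e' (by simp) (by simp)]
    simp only [ih'']
    cases hit (cs ++ [y.1]) cs.length e <;> cases hit (cs ++ [y.1]) cs.length e' <;> simp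

lemma Learner.expect_pick (P : ℕ → Learner) (vs : List (Fin N)) (cs : List (Circuit × Circuit))
    (m : ℕ) : ∀ b, 2 ^ m * expect ((Learner.pick P m b).runFrom Λ B vs cs) h
      = ∑ t ∈ Finset.range (2 ^ m), expect ((P (b + t)).runFrom Λ B vs cs) h := by
  induction m with
  | zero =>
    intro b
    simp [Learner.pick]
  | succ m ih =>
    intro b
    rw [Learner.pick, Learner.runFrom, expect_addTime, expect_fairCoin]
    simp only [if_true, Bool.false_eq_true, if_false]
    rw [pow_succ, pow_succ, mul_two (2 ^ m : ℕ), Finset.sum_range_add, ← ih b]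
    simp only [← add_assoc]
    rw [← ih (b + 2 ^ m), ← mul_add, mul_assoc, ← mul_assoc 2,
      ENNReal.mul_inv_cancel (by simp) (by simp), one_mul, mul_add]

end Learner

/-! ### Correctness and running time of the sampler -/

lemma weight_pos {N : ℕ} {k : ℕ} (hk : 1 ≤ k) (cs : List (Circuit × Circuit))
    (e : Fin N × Fin N) (l : List (ℕ × Bool)) : 0 < weight k cs e l :=
  lt_of_lt_of_le (by positivity) (half_pow_length_le_weight hk cs e l)

lemma sum_weight_pos {N : ℕ} (hN : 0 < N) {k : ℕ} (hk : 1 ≤ k) (cs : List (Circuit × Circuit))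
    (l : List (ℕ × Bool)) : 0 < ∑ e : Fin N × Fin N, weight k cs e l :=
  Finset.sum_pos (fun e _ => weight_pos hk cs e l) ⟨(⟨0, hN⟩, ⟨0, hN⟩), Finset.mem_univ _⟩

lemma half_pow_length_le_meanWeight {N : ℕ} (hN : 0 < N) {k : ℕ} (hk : 1 ≤ k)
    (cs : List (Circuit × Circuit)) (l : List (ℕ × Bool)) :
    (1 / 2 : ℝ) ^ l.length ≤ meanWeight N k cs l := by
  have hN' : (0 : ℝ) < N := by exact_mod_cast hN
  rw [meanWeight, le_div_iff₀ (by positivity)]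
  have := Finset.sum_le_sum fun (e : Fin N × Fin N) (_ : e ∈ Finset.univ) =>
    half_pow_length_le_weight hk cs e l
  rw [Finset.sum_const, Finset.card_univ, Fintype.card_prod, Fintype.card_fin, nsmul_eq_mul] at this
  push_cast at this
  linarith

lemma meanWeight_le_one {N : ℕ} (hN : 0 < N) (k : ℕ) (cs : List (Circuit × Circuit))
    (l : List (ℕ × Bool)) : meanWeight N k cs l ≤ 1 := by
  have hN' : (0 : ℝ) < N := by exact_mod_cast hN
  rw [meanWeight, div_le_one (by positivity)]
  have := Finset.sum_le_sum fun (e : Fin N × Fin N) (_ : e ∈ Finset.univ) =>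
    weight_le_one k cs e l
  rw [Finset.sum_const, Finset.card_univ, Fintype.card_prod, Fintype.card_fin, nsmul_eq_mul] at this
  push_cast at this
  linarith

/-- The distribution proportional to the weight. -/
def weightObject {N : ℕ} (hN : 0 < N) {k : ℕ} (hk : 1 ≤ k) (cs : List (Circuit × Circuit))
    (l : List (ℕ × Bool)) : Object N :=
  PMF.ofFintype (fun e => ENNReal.ofReal (weight k cs e l / ∑ e' : Fin N × Fin N, weight k cs e' l))
    (by
      have h := sum_weight_pos hN hk cs l
      rw [← ENNReal.ofReal_sum_of_nonneg fun e _ => div_nonneg (weight_nonneg _ _ _ _) h.le,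
        ← Finset.sum_div, div_self h.ne', ENNReal.ofReal_one])

lemma rectProb_weightObject {N : ℕ} (hN : 0 < N) {k : ℕ} (hk : 1 ≤ k)
    (cs : List (Circuit × Circuit)) (l : List (ℕ × Bool)) (U V : Finset (Fin N)) :
    rectProb (weightObject hN hk cs l) U V
      = predProb (fun u v => weight k cs (u, v) l) U V := by
  have h := sum_weight_pos hN hk cs l
  have h' : ∀ e : Fin N × Fin N, (weightObject hN hk cs l e).toReal
      = weight k cs e l / ∑ e' : Fin N × Fin N, weight k cs e' l := fun e =>
    ENNReal.toReal_ofReal (div_nonneg (weight_nonneg _ _ _ _) h.le)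
  rw [rectProb_eq_sum, predProb, Finset.sum_congr rfl fun e _ => h' e, ← Finset.sum_div,
    Finset.sum_product, Fintype.sum_prod_type]

lemma expect_attempts_succ {α : Type} (μ : PMF (Option α × ℕ)) (h : Option α → ℝ≥0∞) (n : ℕ) :
    expect (attempts μ (n + 1)) h
      = expect μ fun o => o.elim (expect (attempts μ n) h) fun a => h (some a) := by
  rw [attempts, expect_bind, expect]
  refine tsum_congr fun x => ?_
  congr 1
  obtain ⟨o, t⟩ := x
  cases o with
  | none => exact expect_addTime _ _ _
  | some a => exact expect_pure _ _ _

/-- A geometric series: one pass outputs `e` with probability w(e)/N² and restarts with probability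
1 - `meanWeight`. -/
lemma expect_attempts_samplerCode {N : ℕ} (hN : 0 < N) {k : ℕ} (hk : 1 ≤ k)
    (cs : List (Circuit × Circuit)) (l : List (ℕ × Bool)) (r : ℕ → Bool) (e : Fin N × Fin N)
    (n : ℕ) :
    expect (attempts ((samplerCode k l).pass cs r []) n)
        (fun o => if o ∈ ({some e} : Set _) then 1 else 0)
      = ENNReal.ofReal (weight k cs e l / (∑ e' : Fin N × Fin N, weight k cs e' l)
        * (1 - (1 - meanWeight N k cs l) ^ n)) := by
  have hN' : (0 : ℝ) < N := by exact_mod_cast hN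
  have hS := sum_weight_pos hN hk cs l
  have hZ1 := meanWeight_le_one hN k cs l
  have hZ0 : 0 ≤ meanWeight N k cs l := (by positivity : (0 : ℝ) ≤ (1 / 2) ^ l.length).trans
    (half_pow_length_le_meanWeight hN hk cs l)
  induction n with
  | zero => simp [attempts, expect_pure]
  | succ n ih =>
    have hsum : ∑ x : Fin N × Fin N, ENNReal.ofReal (weight k cs x l / (N : ℝ) ^ 2) *
        (if some x ∈ ({some e} : Set _) then 1 else 0)
        = ENNReal.ofReal (weight k cs e l / (N : ℝ) ^ 2) := by
      simp
    rw [expect_attempts_succ, expect_samplerCode hN]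
    simp only [Option.elim]
    rw [ih, hsum, ← ENNReal.ofReal_mul (by linarith), ← ENNReal.ofReal_add]
    · congr 1
      have : weight k cs e l / (N : ℝ) ^ 2
          = weight k cs e l / (∑ e' : Fin N × Fin N, weight k cs e' l) * meanWeight N k cs l := by
        rw [meanWeight]
        field_simp
      rw [this, pow_succ]
      ring
    · exact div_nonneg (weight_nonneg _ _ _ _) (by positivity)
    · refine mul_nonneg (by linarith) (mul_nonneg (div_nonneg (weight_nonneg _ _ _ _) hS.le) ?_)
      exact sub_nonneg.2 (pow_le_one₀ (by linarith) (by linarith))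

lemma implements_weightObject {N : ℕ} (hN : 0 < N) {k : ℕ} (hk : 1 ≤ k)
    (cs : List (Circuit × Circuit)) (l : List (ℕ × Bool)) :
    Implementation.Implements ⟨0, samplerCode k l, cs⟩ (PMF.pure (weightObject hN hk cs l)) := by
  refine ⟨fun _ => weightObject hN hk cs l, fun r e => ?_, ?_⟩
  · have hZ1 := meanWeight_le_one hN k cs l
    have hZ0 : 0 < meanWeight N k cs l := (by positivity : (0 : ℝ) < (1 / 2) ^ l.length).trans_le
      (half_pow_length_le_meanWeight hN hk cs l)
    have h₁ : ∀ n, (Implementation.runUpTo N ⟨0, samplerCode k l, cs⟩ r n).toOuterMeasure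
        {x | x.1 = some e}
        = ENNReal.ofReal (weight k cs e l / (∑ e' : Fin N × Fin N, weight k cs e' l)
          * (1 - (1 - meanWeight N k cs l) ^ n)) := fun n =>
      (toOuterMeasure_eq_expect _ {some e}).trans (expect_attempts_samplerCode hN hk cs l _ e n)
    simp only [h₁]
    have h₂ : Tendsto (fun n => weight k cs e l / (∑ e' : Fin N × Fin N, weight k cs e' l)
        * (1 - (1 - meanWeight N k cs l) ^ n)) atTop
        (𝓝 (weight k cs e l / (∑ e' : Fin N × Fin N, weight k cs e' l) * (1 - 0))) :=
      ((tendsto_pow_atTop_nhds_zero_of_lt_one (by linarith) (by linarith)).const_sub 1).const_mul _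
    rw [sub_zero, mul_one] at h₂
    exact ENNReal.tendsto_ofReal h₂
  · exact (PMF.map_const _ _).symm

lemma indistinguishable_pure {N : ℕ} {ε : ℝ} {B O : Object N} {𝓓 : Set (Distinguisher N)}
    (h : ∀ D ∈ 𝓓, |rectProb B D.U D.V - rectProb O D.U D.V| ≤ ε) :
    Indistinguishable ε B (PMF.pure O) 𝓓 := by
  intro D hD
  rw [tsum_eq_single O]
  · simpa [Distinguisher.acceptProb] using h D hD
  · intro B' hB'
    simp [PMF.pure_apply, hB']

lemma tsum_attempts_time_succ {α : Type} (μ : PMF (Option α × ℕ)) (n : ℕ) :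
    ∑' x, attempts μ (n + 1) x * (x.2 : ℝ≥0∞) = ∑' x, μ x * (x.2 : ℝ≥0∞)
      + expect μ fun o => o.elim (∑' x, attempts μ n x * (x.2 : ℝ≥0∞)) fun _ => 0 := by
  rw [attempts, tsum_bind_mul, expect, ← ENNReal.tsum_add]
  refine tsum_congr fun x => ?_
  rw [← mul_add]
  congr 1
  obtain ⟨o, t⟩ := x
  cases o with
  | none =>
    simp only [addTime, Option.elim]
    rw [tsum_map_mul]
    simp only [Nat.cast_add, mul_add, ENNReal.tsum_add, ENNReal.tsum_mul_right, PMF.tsum_coe,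
      one_mul]
  | some a =>
    simp only [Option.elim, add_zero]
    exact tsum_pure_mul _ _

/-- If τ bounds the time of a pass, then τ 2ᵀ is the fixed point of x ↦ τ + (1 - 2⁻ᵀ) x, and a pass
restarts with probability at most 1 - 2⁻ᵀ. -/
lemma expectedTimeLE_samplerCode {N : ℕ} (hN : 0 < N) {k : ℕ} (hk : 1 ≤ k)
    {cs : List (Circuit × Circuit)} {W : ℕ} (hcs : SizesLE cs W) {l : List (ℕ × Bool)} {T : ℕ}
    (hl : l.length ≤ T) :
    Implementation.ExpectedTimeLE N ⟨0, samplerCode k l, cs⟩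
      ((samplerCode k l).cost * ((1 + Nat.log 2 N) * (1 + W)) * 2 ^ T) := by
  intro r n
  rw [Implementation.runUpTo]
  set μ := (samplerCode k l).pass cs
    (fun i => if h : i < (⟨0, samplerCode k l, cs⟩ : Implementation).seedLen then r ⟨i, h⟩
      else false) ([] : List (Fin N)) with hμ
  set τ : ℕ := (samplerCode k l).cost * ((1 + Nat.log 2 N) * (1 + W)) with hτ
  have hpass : ∑' x, μ x * (x.2 : ℝ≥0∞) ≤ τ := by
    calc ∑' x, μ x * (x.2 : ℝ≥0∞) ≤ ∑' x, μ x * (τ : ℝ≥0∞) := by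
          refine ENNReal.tsum_le_tsum fun x => ?_
          by_cases hx : μ x = 0
          · simp [hx]
          · refine mul_le_mul_right ?_ _
            exact_mod_cast SamplerCode.pass_time_le hcs _ (samplerCode k l) [] x hx
      _ = τ := by rw [ENNReal.tsum_mul_right, PMF.tsum_coe, one_mul]
  have hZ : (1 / 2 : ℝ) ^ T ≤ meanWeight N k cs l :=
    (pow_le_pow_of_le_one (by norm_num) (by norm_num) hl).trans
      (half_pow_length_le_meanWeight hN hk cs l)
  have hT1 : (1 / 2 : ℝ) ^ T ≤ 1 := pow_le_one₀ (by norm_num) (by norm_num)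
  induction n with
  | zero =>
    rw [attempts, tsum_pure_mul]
    simp
  | succ n ih =>
    rw [tsum_attempts_time_succ]
    have h₁ : (expect μ fun o => o.elim (∑' x, attempts μ n x * (x.2 : ℝ≥0∞)) fun _ => 0)
        ≤ ENNReal.ofReal (1 - (1 / 2) ^ T) * ((τ * 2 ^ T : ℕ) : ℝ≥0∞) := by
      rw [hμ, expect_samplerCode hN]
      simp only [Option.elim, mul_zero, Finset.sum_const_zero, zero_add]
      exact mul_le_mul' (ENNReal.ofReal_le_ofReal (by linarith)) ih
    refine (add_le_add hpass h₁).trans (le_of_eq ?_)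
    rw [← ENNReal.ofReal_natCast, ← ENNReal.ofReal_natCast, ← ENNReal.ofReal_mul (by linarith),
      ← ENNReal.ofReal_add (by positivity) (mul_nonneg (by linarith) (by positivity))]
    congr 1
    push_cast
    have : (1 / 2 : ℝ) ^ T * 2 ^ T = 1 := by rw [← mul_pow]; norm_num
    linear_combination -(τ : ℝ) * this

/-! ### The potential -/

/-- The potential of the current weight, bounded below by zero if `D` is large enough. -/
def potential {N : ℕ} (B : Object N) (D : ℝ) (k : ℕ) (cs : List (Circuit × Circuit))
    (l : List (ℕ × Bool)) : ℝ :=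
  D - logLik (fun e => (B e).toReal) (fun e => weight k cs e l)
    - Real.log (Fintype.card (Fin N × Fin N))

lemma sum_toReal_eq_one {α : Type} [Fintype α] (B : PMF α) : ∑ e, (B e).toReal = 1 := by
  rw [← ENNReal.toReal_sum fun e _ => B.apply_ne_top e, ← tsum_fintype (L := .unconditional _),
    PMF.tsum_coe, ENNReal.toReal_one]

lemma potential_nil {N : ℕ} (B : Object N) (D : ℝ) (k : ℕ) (cs : List (Circuit × Circuit)) :
    potential B D k cs [] = D := by
  simp [potential, logLik, weight]

lemma potential_append {N : ℕ} (B : Object N) (D : ℝ) (k : ℕ) (cs : List (Circuit × Circuit))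
    (c : Circuit × Circuit) (l : List (ℕ × Bool)) (hl : ∀ x ∈ l, x.1 < cs.length) :
    potential B D k (cs ++ [c]) l = potential B D k cs l := by
  simp only [potential, weight_append k cs c _ l hl]

lemma potential_nonneg {N : ℕ} (hN : 0 < N) {B : Object N} {γ : ℝ} (hγ : 0 ≤ γ) {T : ℕ}
    (hB : ∀ U V : Finset (Fin N), ∑ e ∈ U ×ˢ V, (B e).toReal
      ≤ 4 * γ * ((U ×ˢ V).card / (N : ℝ) ^ 2 + (1 / 4) ^ T)) {k : ℕ} (hk : 1 ≤ k)
    (cs : List (Circuit × Circuit)) {l : List (ℕ × Bool)} (hl : l.length ≤ T) :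
    0 ≤ potential B (8 * γ) k cs l := by
  have : Nonempty (Fin N) := ⟨⟨0, hN⟩⟩
  have h₁ : DominatedOnRects (fun e => (B e).toReal) (fun _ => 1) (4 * γ) ((1 / 4) ^ T) := by
    intro U V
    simpa using hB U V
  have h₂ := dominatedOnRects_weight (by positivity) (by positivity) h₁ k cs l
    Finset.univ Finset.univ
  rw [Finset.univ_product_univ] at h₂
  -- The initial error 4⁻ᵀ, doubled at most T times, is still at most 2⁻ᵀ, and no weight is below
  -- that. The error is thus absorbed by the mean weight, which turns 4γ into 8γ.
  have h₃ : (2 : ℝ) ^ l.length * (1 / 4) ^ T ≤ meanWeight N k cs l := by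
    refine le_trans ?_ (half_pow_length_le_meanWeight hN hk cs l)
    calc (2 : ℝ) ^ l.length * (1 / 4) ^ T ≤ 2 ^ T * (1 / 4) ^ T := by
          gcongr
          norm_num
      _ = (1 / 2) ^ T := by rw [← mul_pow]; norm_num
      _ ≤ (1 / 2) ^ l.length := pow_le_pow_of_le_one (by norm_num) (by norm_num) hl
  have h₄ := logLik_add_log_card_le (D := 8 * γ) (fun e => ENNReal.toReal_nonneg)
    (sum_toReal_eq_one B) (fun e => weight_pos hk cs e l) (by
      refine h₂.trans ?_
      have : ((Fintype.card (Fin N × Fin N) : ℕ) : ℝ) = (N : ℝ) ^ 2 := by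
        rw [Fintype.card_prod, Fintype.card_fin]
        push_cast
        ring
      rw [this]
      rw [meanWeight] at h₃
      nlinarith)
  rw [potential]
  linarith

lemma potential_cons_le {N : ℕ} (hN : 0 < N) (B : Object N) (D : ℝ) {k : ℕ} (hk : 1 ≤ k)
    (cs : List (Circuit × Circuit)) (l : List (ℕ × Bool)) (r : ℕ) (d : Bool) :
    potential B D k cs ((r, d) :: l) ≤ potential B D k cs l
      - (1 / 2) ^ k * ((∑ e : Fin N × Fin N, if hit cs r e ≠ d then weight k cs e l else 0)
        / ∑ e : Fin N × Fin N, weight k cs e l)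
      + ((1 / 2) ^ k + 2 * ((1 / 2) ^ k) ^ 2)
        * ∑ e : Fin N × Fin N, if hit cs r e ≠ d then (B e).toReal else 0 := by
  have : Nonempty (Fin N) := ⟨⟨0, hN⟩⟩
  have hk' : (1 / 2 : ℝ) ^ k ≤ 1 / 2 := by
    simpa using pow_le_pow_of_le_one (by norm_num : (0 : ℝ) ≤ 1 / 2) (by norm_num) hk
  have h := logLik_penalize (b := fun e => (B e).toReal) (f := fun e => weight k cs e l)
    (fun e => ENNReal.toReal_nonneg) (fun e => weight_pos hk cs e l) (fun e => hit cs r e ≠ d)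
    (by positivity) hk'
  have e₁ : (fun e : Fin N × Fin N => weight k cs e ((r, d) :: l))
      = fun e => weight k cs e l * if hit cs r e ≠ d then 1 - (1 / 2) ^ k else 1 := by
    ext e
    rw [weight]
    by_cases hd : hit cs r e = d <;> simp [hd]
  rw [potential, potential, e₁]
  linarith

/-! ### One round -/

lemma drawValue_mono {A A' ν x x' : ℝ≥0∞} (hA : A ≤ A') (hx : x ≤ x') (K : ℕ) :
    drawValue A ν x K ≤ drawValue A' ν x' K := by
  induction K with
  | zero => exact hx
  | succ K ih => exact add_le_add hA (mul_le_mul_right ih _)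

lemma drawValue_add (A A' ν x x' : ℝ≥0∞) (K : ℕ) :
    drawValue (A + A') ν (x + x') K = drawValue A ν x K + drawValue A' ν x' K := by
  induction K with
  | zero => rfl
  | succ K ih =>
    simp only [drawValue, ih]
    ring

lemma drawValue_mul (s A ν x : ℝ≥0∞) (K : ℕ) :
    drawValue (s * A) ν (s * x) K = s * drawValue A ν x K := by
  induction K with
  | zero => rfl
  | succ K ih =>
    simp only [drawValue, ih]
    ring

/-- Here `y` is the value without progress and `g` the gain of a completed draw. Some attempt among
K succeeds with probability 1 - (1 - Z)ᴷ, and that fraction of `g` is kept. -/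
lemma drawValue_le {Z y g : ℝ} (hZ₁ : Z ≤ 1) (hZ₀ : 0 ≤ Z) (hg : 0 ≤ g) (hyg : 0 ≤ y - g)
    {A x : ℝ≥0∞} (hA : A ≤ ENNReal.ofReal (Z * (y - g))) (hx : x ≤ ENNReal.ofReal y) (K : ℕ) :
    drawValue A (ENNReal.ofReal (1 - Z)) x K
      ≤ ENNReal.ofReal (y - (1 - (1 - Z) ^ K) * g) := by
  induction K with
  | zero => simpa [drawValue] using hx
  | succ K ih =>
    have hp : (1 - Z) ^ K ≤ 1 := pow_le_one₀ (by linarith) (by linarith)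
    have hp' : 0 ≤ (1 - Z) ^ K := pow_nonneg (by linarith) _
    have hnn : 0 ≤ y - (1 - (1 - Z) ^ K) * g := by nlinarith
    rw [drawValue]
    refine (add_le_add hA (mul_le_mul_right ih _)).trans (le_of_eq ?_)
    rw [← ENNReal.ofReal_mul (by linarith), ← ENNReal.ofReal_add (mul_nonneg hZ₀ hyg)
      (mul_nonneg (by linarith) hnn)]
    congr 1
    rw [pow_succ]
    ring

/-- For z = 2⁻ᵀ, Bernoulli's inequality gives (1 + z)^(2ᵀ) ≥ 2, and (1 - z)(1 + z) ≤ 1. -/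
lemma one_sub_pow_le_half {Z : ℝ} (hZ₁ : Z ≤ 1) {T : ℕ} (hZ : (1 / 2 : ℝ) ^ T ≤ Z) :
    (1 - Z) ^ 2 ^ T ≤ 1 / 2 := by
  set z : ℝ := (1 / 2) ^ T with hz
  have hz0 : 0 < z := by positivity
  have h₁ : (1 - Z) ^ 2 ^ T ≤ (1 - z) ^ 2 ^ T := by
    gcongr
  have h₂ : 2 ≤ (1 + z) ^ 2 ^ T := by
    have := one_add_mul_le_pow (by linarith : (-2 : ℝ) ≤ z) (2 ^ T)
    push_cast at this
    have h : (2 : ℝ) ^ T * z = 1 := by rw [hz, ← mul_pow]; norm_num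
    linarith
  have h₃ : (1 - z) ^ 2 ^ T * (1 + z) ^ 2 ^ T ≤ 1 := by
    rw [← mul_pow]
    refine pow_le_one₀ ?_ ?_ <;> nlinarith
  have h₄ : 0 ≤ (1 - z) ^ 2 ^ T := pow_nonneg (by linarith) _
  nlinarith

section Rounds

variable {N : ℕ} (Λ : AuditAlg N) (B : Object N)

lemma roundValue_add (k K : ℕ) (ψ ψ' : List (Circuit × Circuit) → List (ℕ × Bool) → ℝ≥0∞)
    (cs : List (Circuit × Circuit)) (l : List (ℕ × Bool)) :
    roundValue Λ B k K (fun cs l => ψ cs l + ψ' cs l) cs l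
      = roundValue Λ B k K ψ cs l + roundValue Λ B k K ψ' cs l := by
  rw [roundValue, roundValue, roundValue, ← expect_add]
  congr 1
  ext c
  rw [← drawValue_add]
  simp only [mul_add, Finset.sum_add_distrib]

lemma roundValue_mul (k K : ℕ) (s : ℝ≥0∞)
    (ψ : List (Circuit × Circuit) → List (ℕ × Bool) → ℝ≥0∞)
    (cs : List (Circuit × Circuit)) (l : List (ℕ × Bool)) :
    roundValue Λ B k K (fun cs l => s * ψ cs l) cs l = s * roundValue Λ B k K ψ cs l := by
  rw [roundValue, roundValue, mul_comm, ← expect_mul_const]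
  congr 1
  ext c
  refine Eq.trans ?_ (mul_comm s _)
  rw [← drawValue_mul]
  simp only [Finset.mul_sum, mul_left_comm s]

lemma roundValue_sum (k K n : ℕ)
    (ψ : ℕ → List (Circuit × Circuit) → List (ℕ × Bool) → ℝ≥0∞)
    (cs : List (Circuit × Circuit)) (l : List (ℕ × Bool)) :
    roundValue Λ B k K (fun cs l => ∑ t ∈ Finset.range n, ψ t cs l) cs l
      = ∑ t ∈ Finset.range n, roundValue Λ B k K (ψ t) cs l := by
  induction n with
  | zero =>
    have := roundValue_mul Λ B k K 0 (fun _ _ => 0) cs l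
    simpa using this
  | succ n ih => simp only [Finset.sum_range_succ, roundValue_add, ih]

/-- The updates so far refer to circuits that are there. -/
def ValidUpdates (cs : List (Circuit × Circuit)) (l : List (ℕ × Bool)) : Prop :=
  ∀ x ∈ l, x.1 < cs.length

variable {Λ B}

lemma ValidUpdates.update {cs : List (Circuit × Circuit)} {l : List (ℕ × Bool)}
    (h : ValidUpdates cs l) (c : Circuit × Circuit) (x y : Bool) :
    ValidUpdates (cs ++ [c]) (update cs.length l x y) ∧
      (update cs.length l x y).length ≤ l.length + 1 := by
  have h' : ∀ z ∈ l, z.1 < cs.length + 1 := fun z hz => (h z hz).trans (Nat.lt_succ_self _)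
  constructor
  · intro z hz
    rw [List.length_append, List.length_singleton]
    cases x <;> cases y <;> simp only [SparseGraph.update, if_true, Bool.false_eq_true, if_false,
      List.mem_cons] at hz
    · exact h' z hz
    · rcases hz with rfl | hz
      exacts [Nat.lt_succ_self _, h' z hz]
    · rcases hz with rfl | hz
      exacts [Nat.lt_succ_self _, h' z hz]
    · exact h' z hz
  · cases x <;> cases y <;> simp [SparseGraph.update]

/-- The comparison is only required at states reachable in one round, because the potential is
controlled only for valid and short update lists. -/
lemma roundValue_mono (k K : ℕ) {ψ ψ' : List (Circuit × Circuit) → List (ℕ × Bool) → ℝ≥0∞}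
    {cs : List (Circuit × Circuit)} {l : List (ℕ × Bool)} (hl : ValidUpdates cs l)
    (h : ∀ cs' l', ValidUpdates cs' l' → l'.length ≤ l.length + 1 → ψ cs' l' ≤ ψ' cs' l') :
    roundValue Λ B k K ψ cs l ≤ roundValue Λ B k K ψ' cs l := by
  refine expect_mono _ fun c => drawValue_mono ?_ ?_ K
  · refine Finset.sum_le_sum fun e' _ => mul_le_mul_right (Finset.sum_le_sum fun e _ =>
      mul_le_mul_right ?_ _) _
    exact h _ _ (hl.update c _ _).1 (hl.update c _ _).2
  · exact h _ _ (hl.update c true true).1 (Nat.le_succ _)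

/-- The gap between the object and the weight on the rectangle of a pair of circuits. -/
def gap (B : Object N) (k : ℕ) (cs : List (Circuit × Circuit)) (l : List (ℕ × Bool))
    (U V : Finset (Fin N)) : ℝ :=
  rectProb B U V - predProb (fun u v => weight k cs (u, v) l) U V

variable {γ : ℝ} {T k : ℕ}

/-- One round, given the auditor's answer `c`. The offset `x` is a budget for the drift of later
rounds, and the division by 2 is the price of cutting the draw off after 2ᵀ attempts. The first
conjunct lets `ENNReal.ofReal` of the bound be added to without loss. -/
lemma draw_potential_le (hN : 0 < N) (hγ : 0 ≤ γ)
    (hB : ∀ U V : Finset (Fin N), ∑ e ∈ U ×ˢ V, (B e).toReal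
      ≤ 4 * γ * ((U ×ˢ V).card / (N : ℝ) ^ 2 + (1 / 4) ^ T)) (hk : 1 ≤ k)
    {cs : List (Circuit × Circuit)} {l : List (ℕ × Bool)} (hl : ValidUpdates cs l)
    (hlT : l.length < T) {x : ℝ} (hx : 0 ≤ x) (c : Circuit × Circuit) :
    0 ≤ potential B (8 * γ) k cs l + x + 2 * ((1 / 2) ^ k) ^ 2
        - (1 / 2) ^ k * gap B k cs l (c.1.toSet N) (c.2.toSet N) ^ 2 / 2 ∧
    drawValue (∑ e' : Fin N × Fin N, ENNReal.ofReal (weight k (cs ++ [c]) e' l / (N : ℝ) ^ 2) *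
        ∑ e, B e * ENNReal.ofReal (potential B (8 * γ) k (cs ++ [c]) (update cs.length l
          (hit (cs ++ [c]) cs.length e) (hit (cs ++ [c]) cs.length e')) + x))
      (ENNReal.ofReal (1 - meanWeight N k (cs ++ [c]) l))
      (ENNReal.ofReal (potential B (8 * γ) k (cs ++ [c]) l + x)) (2 ^ T)
    ≤ ENNReal.ofReal (potential B (8 * γ) k cs l + x + 2 * ((1 / 2) ^ k) ^ 2
        - (1 / 2) ^ k * gap B k cs l (c.1.toSet N) (c.2.toSet N) ^ 2 / 2) := by
  have hN' : (0 : ℝ) < N := by exact_mod_cast hN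
  set a : ℝ := (1 / 2) ^ k with ha
  have ha0 : 0 ≤ a := by positivity
  have hΦ : potential B (8 * γ) k (cs ++ [c]) l = potential B (8 * γ) k cs l :=
    potential_append B _ k cs c l hl
  have hmean : meanWeight N k (cs ++ [c]) l = meanWeight N k cs l := by
    simp only [meanWeight, weight_append k cs c _ l hl]
  have hw : ∀ e : Fin N × Fin N, weight k (cs ++ [c]) e l = weight k cs e l := fun e =>
    weight_append k cs c e l hl
  -- One more update still leaves at most T of them, so `ENNReal.ofReal` truncates nothing below.
  have hnn : ∀ d d' : Bool,
      0 ≤ potential B (8 * γ) k (cs ++ [c]) (update cs.length l d d') + x := fun d d' =>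
    add_nonneg (potential_nonneg hN hγ hB hk _ ((hl.update c d d').2.trans hlT)) hx
  have hS := sum_weight_pos hN hk cs l
  set S := ∑ e : Fin N × Fin N, weight k cs e l with hSdef
  set b : Fin N × Fin N → ℝ := fun e => (B e).toReal with hb
  have hb1 : ∑ e, b e = 1 := sum_toReal_eq_one B
  set R : Fin N × Fin N → Bool := hit (cs ++ [c]) cs.length with hR
  set β := ∑ e, if R e then b e else 0 with hβ
  set q := (∑ e, if R e then weight k cs e l else 0) / S with hq
  have hRU : ∀ e : Fin N × Fin N, R e = true ↔ e ∈ c.1.toSet N ×ˢ c.2.toSet N := by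
    intro e
    rw [hR, hit_append_length, decide_eq_true_iff, Finset.mem_product]
  have hgap : gap B k cs l (c.1.toSet N) (c.2.toSet N) = β - q := by
    rw [gap, rectProb_eq_sum, predProb, hβ, hq, ← Finset.sum_product', hSdef,
      Fintype.sum_prod_type (fun e : Fin N × Fin N => weight k cs e l)]
    simp only [hRU, Finset.sum_ite_mem, Finset.univ_inter, hb]
  rw [hgap, hΦ, hmean]
  set Φ := potential B (8 * γ) k cs l with hΦdef
  have c₁ : ∀ f : Fin N × Fin N → ℝ, (∑ e, if R e ≠ true then f e else 0)
      = ∑ e, f e - ∑ e, if R e then f e else 0 := by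
    intro f
    rw [← Finset.sum_sub_distrib]
    refine Finset.sum_congr rfl fun e _ => ?_
    cases R e <;> simp
  have c₂ : ∀ f : Fin N × Fin N → ℝ, (∑ e, if R e ≠ false then f e else 0)
      = ∑ e, if R e then f e else 0 := by
    intro f
    refine Finset.sum_congr rfl fun e _ => ?_
    cases R e <;> simp
  have k₁ : potential B (8 * γ) k (cs ++ [c]) ((cs.length, true) :: l) + x
      ≤ Φ + x - a * (β - q) + 2 * a ^ 2 * (1 - β) := by
    have := potential_cons_le hN B (8 * γ) hk (cs ++ [c]) l cs.length true
    rw [hΦ, ← hR, ← ha] at this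
    simp only [hw] at this
    rw [c₁, c₁, hb1, ← hβ, ← hSdef, sub_div, div_self hS.ne', ← hq] at this
    linarith
  have k₂ : potential B (8 * γ) k (cs ++ [c]) ((cs.length, false) :: l) + x
      ≤ Φ + x + a * (β - q) + 2 * a ^ 2 * β := by
    have := potential_cons_le hN B (8 * γ) hk (cs ++ [c]) l cs.length false
    rw [hΦ, ← hR, ← ha] at this
    simp only [hw] at this
    rw [c₂, c₂, ← hβ, ← hSdef, ← hq] at this
    linarith
  have havg := average_update_le (f := fun e => weight k cs e l)
    (fun e => ENNReal.toReal_nonneg) hb1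
    (fun e => weight_nonneg k cs e l) hS R hβ hq k₁ k₂
  have hcase : ∀ e e' : Fin N × Fin N,
      potential B (8 * γ) k (cs ++ [c]) (update cs.length l (R e) (R e')) + x
      = if R e then (if R e' then Φ + x
          else potential B (8 * γ) k (cs ++ [c]) ((cs.length, true) :: l) + x)
        else (if R e' then potential B (8 * γ) k (cs ++ [c]) ((cs.length, false) :: l) + x
          else Φ + x) := by
    intro e e'
    cases R e <;> cases R e' <;> simp [update, hΦ]
  simp only [← hcase, ← hSdef] at havg
  set X : ℝ := ∑ e' : Fin N × Fin N, weight k cs e' l * ∑ e, b e *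
    (potential B (8 * γ) k (cs ++ [c]) (update cs.length l (R e) (R e')) + x) with hX
  have hinner : ∀ e' : Fin N × Fin N, 0 ≤ ∑ e, b e *
      (potential B (8 * γ) k (cs ++ [c]) (update cs.length l (R e) (R e')) + x) := fun e' =>
    Finset.sum_nonneg fun e _ => mul_nonneg ENNReal.toReal_nonneg (hnn _ _)
  have hX0 : 0 ≤ X := Finset.sum_nonneg fun e' _ =>
    mul_nonneg (weight_nonneg _ _ _ _) (hinner e')
  -- The bound inherits nonnegativity from the averaged potential `X` that it dominates.
  have hy : 0 ≤ Φ + x + 2 * a ^ 2 - a * (β - q) ^ 2 :=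
    nonneg_of_mul_nonneg_right (hX0.trans havg) hS
  have hg : 0 ≤ a * (β - q) ^ 2 := by positivity
  refine ⟨by linarith, ?_⟩
  have hZ1 := meanWeight_le_one hN k cs l
  have hZ := (pow_le_pow_of_le_one (by norm_num) (by norm_num) hlT.le).trans
    (half_pow_length_le_meanWeight hN hk cs l)
  have hA : (∑ e' : Fin N × Fin N, ENNReal.ofReal (weight k (cs ++ [c]) e' l / (N : ℝ) ^ 2) *
        ∑ e, B e * ENNReal.ofReal (potential B (8 * γ) k (cs ++ [c])
          (update cs.length l (R e) (R e')) + x))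
      ≤ ENNReal.ofReal (meanWeight N k cs l * (Φ + x + 2 * a ^ 2 - a * (β - q) ^ 2)) := by
    have : (∑ e' : Fin N × Fin N, ENNReal.ofReal (weight k (cs ++ [c]) e' l / (N : ℝ) ^ 2) *
        ∑ e, B e * ENNReal.ofReal (potential B (8 * γ) k (cs ++ [c])
          (update cs.length l (R e) (R e')) + x)) = ENNReal.ofReal (X / (N : ℝ) ^ 2) := by
      rw [hX, Finset.sum_div, ENNReal.ofReal_sum_of_nonneg fun e' _ =>
        div_nonneg (mul_nonneg (weight_nonneg _ _ _ _) (hinner e')) (by positivity)]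
      refine Finset.sum_congr rfl fun e' _ => ?_
      rw [hw, mul_div_right_comm, ENNReal.ofReal_mul
        (div_nonneg (weight_nonneg _ _ _ _) (by positivity)),
        ENNReal.ofReal_sum_of_nonneg fun e _ => mul_nonneg ENNReal.toReal_nonneg (hnn _ _)]
      congr 1
      refine Finset.sum_congr rfl fun e _ => ?_
      rw [ENNReal.ofReal_mul ENNReal.toReal_nonneg, ENNReal.ofReal_toReal (B.apply_ne_top e)]
    rw [this]
    refine ENNReal.ofReal_le_ofReal ?_
    rw [meanWeight, div_mul_eq_mul_div]
    gcongr
  have hdraw := drawValue_le hZ1 (le_trans (by positivity) hZ) hg hy hA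
    (x := ENNReal.ofReal (Φ + x)) (ENNReal.ofReal_le_ofReal (by nlinarith)) (2 ^ T)
  refine hdraw.trans (ENNReal.ofReal_le_ofReal ?_)
  have := one_sub_pow_le_half hZ1 hZ
  nlinarith

/-- The weight is not `ε`-indistinguishable from the object. -/
def Bad (B : Object N) (ε : ℝ) (𝓓 : Set (Distinguisher N)) (k : ℕ)
    (cs : List (Circuit × Circuit)) (l : List (ℕ × Bool)) : Prop :=
  ∃ D ∈ 𝓓, ε < |gap B k cs l D.U D.V|

open Classical in
-- From a bad weight the auditor finds a gap of at least ε' with probability at least 1 - δ', and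
-- then the round gains at least aε'²/2. Otherwise the expected potential rises by at most 2a².
lemma roundValue_potential_le {ε ε' δ' : ℝ} {𝓑 : Set (Object N)} {𝓓 : Set (Distinguisher N)}
    (hε' : 0 ≤ ε') (hδ' : δ' ≤ 1)
    (hΛ : IsAuditor Λ ε ε' δ' 𝓑 {S | ∃ D ∈ 𝓓, S = (D.U, D.V)}) (hB𝓑 : B ∈ 𝓑)
    (hN : 0 < N) (hγ : 0 ≤ γ)
    (hB : ∀ U V : Finset (Fin N), ∑ e ∈ U ×ˢ V, (B e).toReal
      ≤ 4 * γ * ((U ×ˢ V).card / (N : ℝ) ^ 2 + (1 / 4) ^ T)) (hk : 1 ≤ k)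
    {cs : List (Circuit × Circuit)} {l : List (ℕ × Bool)} (hl : ValidUpdates cs l)
    (hlT : l.length < T) {x : ℝ} (hx : 0 ≤ x) :
    (ENNReal.ofReal ((1 / 2) ^ k * ε' ^ 2 / 2 * (1 - δ')) * if Bad B ε 𝓓 k cs l then 1 else 0)
      + roundValue Λ B k (2 ^ T) (fun cs l => ENNReal.ofReal (potential B (8 * γ) k cs l + x)) cs l
      ≤ ENNReal.ofReal (potential B (8 * γ) k cs l + x + 2 * ((1 / 2) ^ k) ^ 2) := by
  set μ := Λ.run B (fun u v => weight k cs (u, v) l) fun _ _ => 0 with hμ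
  set a : ℝ := (1 / 2) ^ k with ha
  set y := potential B (8 * γ) k cs l + x + 2 * a ^ 2 with hy
  set A : Set (Circuit × Circuit) :=
    {c | ε' ≤ |gap B k cs l (c.1.toSet N) (c.2.toSet N)|} with hA
  have h₁ : (ENNReal.ofReal (a * ε' ^ 2 / 2 * (1 - δ')) * if Bad B ε 𝓓 k cs l then 1 else 0)
      ≤ expect μ fun c => (if c ∈ A then 1 else 0) * ENNReal.ofReal (a * ε' ^ 2 / 2) := by
    split_ifs with hbad
    · obtain ⟨D, hD, hgap⟩ := hbad
      have := hΛ B hB𝓑 (fun u v => weight k cs (u, v) l)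
        (fun u v => ⟨weight_nonneg _ _ _ _, weight_le_one _ _ _ _⟩)
        (by rw [← Fintype.sum_prod_type']; exact sum_weight_pos hN hk cs l)
        ⟨(D.U, D.V), ⟨D, hD, rfl⟩, hgap.le⟩
      rw [mul_one, expect_mul_const, mul_comm, ENNReal.ofReal_mul (by linarith),
        ← toOuterMeasure_eq_expect]
      refine mul_le_mul_left ?_ _
      exact ENNReal.ofReal_le_of_le_toReal this
    · simp
  refine (add_le_add_left h₁ _).trans ?_
  rw [roundValue, ← hμ, ← expect_add, ← expect_const μ (ENNReal.ofReal y)]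
  refine expect_mono μ fun c => ?_
  obtain ⟨h₂, h₃⟩ := draw_potential_le hN hγ hB hk hl hlT hx c
  rw [← ha, ← hy] at h₂ h₃
  refine (add_le_add_right h₃ _).trans ?_
  split_ifs with hc
  · rw [one_mul, ← ENNReal.ofReal_add (by positivity) h₂]
    refine ENNReal.ofReal_le_ofReal ?_
    have : ε' ^ 2 ≤ gap B k cs l (c.1.toSet N) (c.2.toSet N) ^ 2 := by
      rw [← sq_abs (gap B k cs l _ _)]
      exact pow_le_pow_left₀ hε' hc 2
    have := mul_le_mul_of_nonneg_left this (by positivity : 0 ≤ a / 2)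
    linarith
  · rw [zero_mul, zero_add]
    refine ENNReal.ofReal_le_ofReal ?_
    have : 0 ≤ a * gap B k cs l (c.1.toSet N) (c.2.toSet N) ^ 2 / 2 := by positivity
    linarith

open Classical in
/-- The expected number of bad weights among those after `0, …, n - 1` rounds is bounded by the
potential. -/
lemma sum_roundsValue_le {ε ε' δ' : ℝ} {𝓑 : Set (Object N)} {𝓓 : Set (Distinguisher N)}
    (hε' : 0 ≤ ε') (hδ' : δ' ≤ 1)
    (hΛ : IsAuditor Λ ε ε' δ' 𝓑 {S | ∃ D ∈ 𝓓, S = (D.U, D.V)}) (hB𝓑 : B ∈ 𝓑)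
    (hN : 0 < N) (hγ : 0 ≤ γ)
    (hB : ∀ U V : Finset (Fin N), ∑ e ∈ U ×ˢ V, (B e).toReal
      ≤ 4 * γ * ((U ×ˢ V).card / (N : ℝ) ^ 2 + (1 / 4) ^ T)) (hk : 1 ≤ k)
    {h : Implementation → ℝ≥0∞}
    (hh : ∀ cs l, h ⟨0, samplerCode k l, cs⟩ ≤ if Bad B ε 𝓓 k cs l then 1 else 0) (n : ℕ) :
    ∀ cs l, ValidUpdates cs l → l.length + n ≤ T →
      ENNReal.ofReal ((1 / 2) ^ k * ε' ^ 2 / 2 * (1 - δ'))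
          * ∑ t ∈ Finset.range n, roundsValue Λ B h k (2 ^ T) t cs l
        ≤ ENNReal.ofReal (potential B (8 * γ) k cs l + n * (2 * ((1 / 2) ^ k) ^ 2)) := by
  induction n with
  | zero => simp
  | succ n ih =>
    intro cs l hl hlT
    -- The term t = 0 judges the current weight; the others are one round followed by the sum for n,
    -- whose drift n · 2a² becomes the offset `x`.
    rw [Finset.sum_range_succ', mul_add, add_comm]
    simp only [roundsValue]
    rw [← roundValue_sum, ← roundValue_mul]
    refine (add_le_add (mul_le_mul_right (hh cs l) _) (roundValue_mono k (2 ^ T) hl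
      fun cs' l' hl' hlen => ih cs' l' hl' (by omega))).trans ?_
    refine (roundValue_potential_le hε' hδ' hΛ hB𝓑 hN hγ hB hk hl (by omega)
      (by positivity)).trans (ENNReal.ofReal_le_ofReal (le_of_eq ?_))
    push_cast
    ring

end Rounds

/-! ### Outputs of the learner -/

lemma Learner.allOutputs_coins {P : ℕ → SamplerCode → Prop} {fail succ : Learner}
    (hf : fail.AllOutputs P) (hs : succ.AllOutputs P) (k : ℕ) :
    (Learner.coins fail succ k).AllOutputs P := by
  induction k with
  | zero => exact hf
  | succ k ih => exact ⟨ih, hs⟩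

lemma Learner.allOutputs_gate {P : ℕ → SamplerCode → Prop} {fail succ : Learner}
    (hf : fail.AllOutputs P) (hs : succ.AllOutputs P) (k i : ℕ) (l : List (ℕ × Bool)) :
    (Learner.gate k i fail succ l).AllOutputs P := by
  induction l with
  | nil => exact hs
  | cons x l ih =>
    have := Learner.allOutputs_coins hf ih k
    obtain ⟨s, d⟩ := x
    cases d <;> simp [Learner.gate, Learner.ifHit, Learner.AllOutputs, ih, this]

lemma Learner.allOutputs_draw {P : ℕ → SamplerCode → Prop} {fail succ : ℕ → Learner}
    (hf : ∀ i, (fail i).AllOutputs P) (hs : ∀ i, (succ i).AllOutputs P) (k : ℕ)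
    (l : List (ℕ × Bool)) (K : ℕ) : ∀ m, (Learner.draw k l fail succ K m).AllOutputs P := by
  induction K with
  | zero => exact hf
  | succ K ih => exact fun m => Learner.allOutputs_gate (ih (m + 2)) (hs m) k m l

lemma Learner.allOutputs_rounds (k K T n : ℕ) : ∀ r m (l : List (ℕ × Bool)), l.length + n ≤ T →
    (Learner.rounds k K n r m l).AllOutputs
      fun s S => s = 0 ∧ ∃ l : List (ℕ × Bool), l.length ≤ T ∧ S = samplerCode k l := by
  induction n with
  | zero => exact fun r m l hl => ⟨rfl, l, hl, rfl⟩
  | succ n ih =>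
    intro r m l hl
    have hu : ∀ x y i, (Learner.rounds k K n (r + 1) i (update r l x y)).AllOutputs
        fun s S => s = 0 ∧ ∃ l : List (ℕ × Bool), l.length ≤ T ∧ S = samplerCode k l := by
      intro x y i
      refine ih _ _ _ ?_
      cases x <;> cases y <;> simp [update] <;> omega
    refine Learner.allOutputs_draw (fun i => ih _ _ _ (by omega)) (fun i => ?_) k l K m
    have hi : ∀ x, (Learner.ifHit r i (i + 1)
        (Learner.rounds k K n (r + 1) (i + 4) (update r l x true))
        (Learner.rounds k K n (r + 1) (i + 4) (update r l x false))).AllOutputs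
        fun s S => s = 0 ∧ ∃ l : List (ℕ × Bool), l.length ≤ T ∧ S = samplerCode k l := fun x =>
      ⟨⟨hu _ _ _, hu _ _ _⟩, hu _ _ _⟩
    exact ⟨⟨hi _, hi _⟩, hi _⟩

lemma Learner.allOutputs_pick {P : ℕ → SamplerCode → Prop} {Q : ℕ → Learner} (m : ℕ) :
    ∀ b, (∀ t < 2 ^ m, (Q (b + t)).AllOutputs P) → (Learner.pick Q m b).AllOutputs P := by
  induction m with
  | zero => exact fun b h => h 0 (by simp)
  | succ m ih =>
    intro b h
    refine ⟨ih b fun t ht => h t (by rw [pow_succ]; omega), ih (b + 2 ^ m) fun t ht => ?_⟩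
    rw [add_assoc]
    exact h _ (by rw [pow_succ]; omega)

/-- The number of rounds is uniform on 2ᵐ values, so the failure probability is at most 2⁻ᵐ times
the expected number of bad weights, which the initial potential 8γ and the total drift bound. -/
lemma isLearner_pick_rounds {N : ℕ} {Λ : AuditAlg N} {γ ε ε' δ' δ'' : ℝ} {k m : ℕ}
    {𝓑 : Set (Object N)} {𝓓 : Set (Distinguisher N)} (hγ : 0 ≤ γ) (hε' : 0 < ε') (hδ' : δ' < 1)
    (hk : 1 ≤ k)
    (hδ'' : 8 * γ + (2 : ℝ) ^ m * (2 * ((1 / 2) ^ k) ^ 2)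
      ≤ (1 / 2) ^ k * ε' ^ 2 / 2 * (1 - δ') * 2 ^ m * δ'')
    (hB : ∀ B ∈ 𝓑, ∀ U V : Finset (Fin N), ∑ e ∈ U ×ˢ V, (B e).toReal
      ≤ 4 * γ * ((U ×ˢ V).card / (N : ℝ) ^ 2 + (1 / 4) ^ 2 ^ m))
    (hΛ : IsAuditor Λ ε ε' δ' 𝓑 {S | ∃ D ∈ 𝓓, S = (D.U, D.V)}) :
    IsLearner (Learner.pick (fun t => Learner.rounds k (2 ^ 2 ^ m) t 0 0 []) m 0) Λ ε δ'' 𝓑 𝓓 := by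
  classical
  intro B hB𝓑
  have hN : 0 < N := B.support_nonempty.some.1.pos
  set L := Learner.pick (fun t => Learner.rounds k (2 ^ 2 ^ m) t 0 0 []) m 0 with hL
  have hout : L.AllOutputs fun s S => s = 0 ∧
      ∃ l : List (ℕ × Bool), l.length ≤ 2 ^ m ∧ S = samplerCode k l :=
    Learner.allOutputs_pick m 0 fun t ht =>
      Learner.allOutputs_rounds k _ (2 ^ m) _ 0 0 [] (by simp; omega)
  refine ⟨fun x hx => ?_, ?_⟩
  · obtain ⟨h₁, l, -, h₂⟩ := Learner.allOutputs_of_mem_support L hout _ _ x hx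
    obtain ⟨⟨s, S, cs⟩, t⟩ := x
    dsimp only at h₁ h₂
    subst h₁ h₂
    exact ⟨_, implements_weightObject hN hk cs l⟩
  · set good : Set Implementation :=
      {T | ∃ M : Model N, T.Implements M ∧ Indistinguishable ε B M 𝓓} with hgood
    set h : Implementation → ℝ≥0∞ := fun T => if T ∈ good then 0 else 1 with hh
    -- The seed is empty, so the implemented model is a point mass at `weightObject`, and its error
    -- on a distinguisher is |`gap`|.
    have hh' : ∀ cs l, h ⟨0, samplerCode k l, cs⟩ ≤ if Bad B ε 𝓓 k cs l then 1 else 0 := by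
      intro cs l
      by_cases hbad : Bad B ε 𝓓 k cs l
      · rw [if_pos hbad, hh]
        dsimp only
        split_ifs <;> simp
      · have : (⟨0, samplerCode k l, cs⟩ : Implementation) ∈ good := by
          refine ⟨_, implements_weightObject hN hk cs l, indistinguishable_pure fun D hD => ?_⟩
          rw [rectProb_weightObject]
          exact not_lt.1 fun hlt => hbad ⟨D, hD, hlt⟩
        simp [hh, this]
    have hsum := sum_roundsValue_le hε'.le hδ'.le hΛ hB𝓑 hN hγ (hB B hB𝓑) hk hh' (2 ^ m) [] []
      (fun x hx => by simp at hx) (by simp)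
    have hpick := Learner.expect_pick Λ B h
      (fun t => Learner.rounds k (2 ^ 2 ^ m) t 0 0 []) [] [] m 0
    have hr : ∀ t, expect ((Learner.rounds k (2 ^ 2 ^ m) t 0 0 []).runFrom Λ B [] []) h
        = roundsValue Λ B h k (2 ^ 2 ^ m) t [] [] := fun t =>
      Learner.expect_rounds Λ B h hN k _ t [] [] []
    simp only [zero_add, hr] at hpick
    rw [← hpick, ← hL, potential_nil] at hsum
    have hadd : expect (L.run Λ B) (fun T => if T ∈ good then 1 else 0) + expect (L.run Λ B) h
        = 1 := by
      rw [← expect_add]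
      refine Eq.trans ?_ (expect_const (L.run Λ B) 1)
      congr 1
      ext T
      by_cases hT : T ∈ good <;> simp [hh, hT]
    rw [← toOuterMeasure_eq_expect] at hadd
    set P := expect (L.run Λ B) h with hP
    set Q := (L.run Λ B).toOuterMeasure {x | x.1 ∈ good} with hQ
    have hPtop : P ≠ ⊤ := fun hp => by simp [hp] at hadd
    have hQtop : Q ≠ ⊤ := fun hq => by simp [hq] at hadd
    have hreal : Q.toReal + P.toReal = 1 := by
      rw [← ENNReal.toReal_add hQtop hPtop, hadd, ENNReal.toReal_one]
    have hpos : 0 < (1 / 2 : ℝ) ^ k * ε' ^ 2 / 2 * (1 - δ') :=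
      mul_pos (by positivity) (by linarith)
    have hsum' := ENNReal.toReal_mono ENNReal.ofReal_ne_top hsum
    change (ENNReal.ofReal ((1 / 2) ^ k * ε' ^ 2 / 2 * (1 - δ')) * (2 ^ m * P)).toReal ≤ _ at hsum'
    rw [ENNReal.toReal_mul, ENNReal.toReal_mul, ENNReal.toReal_ofReal hpos.le,
      ENNReal.toReal_ofReal (by positivity), ENNReal.toReal_pow, ENNReal.toReal_ofNat] at hsum'
    push_cast at hsum'
    have hle : P.toReal ≤ δ'' := by
      have h2 : 0 < (1 / 2 : ℝ) ^ k * ε' ^ 2 / 2 * (1 - δ') * 2 ^ m := by positivity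
      refine le_of_mul_le_mul_left ?_ h2
      linarith
    change 1 - δ'' ≤ Q.toReal
    linarith

/-! ### Choice of the parameters and the main theorem -/

lemma exists_parameters {γ κ δ'' : ℝ} (hκ : 0 < κ) (hδ'' : 0 < δ'') :
    ∃ k m : ℕ, 1 ≤ k ∧ 8 * γ + (2 : ℝ) ^ m * (2 * ((1 / 2) ^ k) ^ 2)
      ≤ (1 / 2) ^ k * κ * 2 ^ m * δ'' := by
  -- With a ≤ κδ''/4 the drift 2a² uses at most half of the allowance aκδ'' of a round.
  obtain ⟨k, hk⟩ := exists_pow_lt_of_lt_one (by positivity : 0 < κ * δ'' / 4)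
    (by norm_num : (1 / 2 : ℝ) < 1)
  have hk' : (1 / 2 : ℝ) ^ (k + 1) ≤ κ * δ'' / 4 :=
    (pow_le_pow_of_le_one (by norm_num) (by norm_num) (Nat.le_succ k)).trans hk.le
  set a : ℝ := (1 / 2) ^ (k + 1) with ha
  have ha0 : 0 < a := by positivity
  -- Over 2ᵐ rounds the other half of the allowance pays for the initial potential 8γ.
  obtain ⟨m, hm⟩ := pow_unbounded_of_one_lt (16 * γ / (a * κ * δ'')) (one_lt_two : (1 : ℝ) < 2)
  refine ⟨k + 1, m, by omega, ?_⟩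
  rw [← ha]
  rw [div_lt_iff₀ (by positivity)] at hm
  have h₂ : 2 ^ m * (2 * a ^ 2) ≤ 2 ^ m * (2 * a * (κ * δ'' / 4)) := by
    refine mul_le_mul_of_nonneg_left ?_ (by positivity)
    nlinarith
  linarith

end SparseGraph

end

open SparseGraph in
theorem mainTheorem3 (γ ε ε' δ' δ'' : ℝ) (hγ : 0 < γ) (hε : 0 < ε) (hε' : 0 < ε')
    (hδ' : 0 < δ') (hδ'_lt : δ' < 1) (hδ'' : 0 < δ'') :
    ∃ η : ℝ, 0 < η ∧ η ≤ 1 ∧ ∃ (L : Learner) (C : ℕ),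
      ∀ (N : ℕ) (𝓑 : Set (Object N)) (𝓓 : Set (Distinguisher N)),
        (∀ B ∈ 𝓑, ∃ G : Digraph (Fin N),
          (∀ v, ¬ G.Adj v v) ∧ IsSupportAccess G B ∧ UpperUniform η γ G) →
        ∀ Λ : AuditAlg N,
          IsAuditor Λ ε ε' δ' 𝓑 {S | ∃ D ∈ 𝓓, S = (D.U, D.V)} →
          IsLearner L Λ ε δ'' 𝓑 𝓓 ∧
          ∀ W₁ W₂ : ℕ, Λ.TimeLE W₁ → Λ.OutputLE W₂ →
            ∀ B ∈ 𝓑, ∀ x ∈ (L.run Λ B).support,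
              x.2 ≤ C * (1 + Nat.log 2 N) * (1 + W₁) * (1 + W₂) ∧
              x.1.ExpectedTimeLE N (C * (1 + Nat.log 2 N) * (1 + W₂)) := by
  obtain ⟨k, m, hk, hkm⟩ := exists_parameters (γ := γ) (κ := ε' ^ 2 / 2 * (1 - δ'))
    (mul_pos (by positivity) (by linarith)) hδ''
  set L := Learner.pick (fun t => Learner.rounds k (2 ^ 2 ^ m) t 0 0 []) m 0 with hL
  -- Here η = 4⁻ᵀ with T = 2ᵐ, which bounds the number of updates. In C, the first summand pays for
  -- the learner and the second for a pass of any sampler it can output, times the bound 2ᵀ on the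
  -- expected number of passes.
  refine ⟨(1 / 4) ^ 2 ^ m, by positivity, pow_le_one₀ (by norm_num) (by norm_num), L,
    L.cost + L.samplerCost * 2 ^ 2 ^ m, fun N 𝓑 𝓓 h𝓑 Λ hΛ => ⟨?_, ?_⟩⟩
  · refine isLearner_pick_rounds hγ.le hε' hδ'_lt hk (by linarith) (fun B hB U V => ?_) hΛ
    obtain ⟨G, hG, hGB, hU⟩ := h𝓑 B hB
    exact rectProb_le_of_upperUniform (by positivity) hγ.le hG hGB hU U V
  · intro W₁ W₂ hW₁ hW₂ B hB x hx
    have hN : 0 < N := B.support_nonempty.some.1.pos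
    obtain ⟨h₁, h₂, h₃⟩ := Learner.run_support hW₁ hW₂ L [] [] (fun c hc => by simp at hc) x hx
    obtain ⟨h₄, l, hl, h₅⟩ := Learner.allOutputs_of_mem_support L
      (Learner.allOutputs_pick m 0 fun t ht =>
        Learner.allOutputs_rounds k (2 ^ 2 ^ m) (2 ^ m) _ 0 0 [] (by simp; omega)) _ _ x hx
    obtain ⟨⟨s, S, cs⟩, t⟩ := x
    dsimp only at h₁ h₂ h₃ h₄ h₅
    subst h₄ h₅
    constructor
    · calc t ≤ L.cost * ((1 + Nat.log 2 N) * (1 + W₁) * (1 + W₂)) := h₁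
        _ ≤ (L.cost + L.samplerCost * 2 ^ 2 ^ m) * ((1 + Nat.log 2 N) * (1 + W₁) * (1 + W₂)) :=
            Nat.mul_le_mul_right _ (Nat.le_add_right _ _)
        _ = _ := by ring
    · intro r n
      refine (expectedTimeLE_samplerCode hN hk h₂ hl r n).trans (Nat.cast_le.2 ?_)
      calc (samplerCode k l).cost * ((1 + Nat.log 2 N) * (1 + W₂)) * 2 ^ 2 ^ m
          = (samplerCode k l).cost * 2 ^ 2 ^ m * ((1 + Nat.log 2 N) * (1 + W₂)) := by ring
        _ ≤ (L.cost + L.samplerCost * 2 ^ 2 ^ m) * ((1 + Nat.log 2 N) * (1 + W₂)) :=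
            Nat.mul_le_mul_right _ ((Nat.mul_le_mul_right _ h₃).trans (Nat.le_add_left _ _))
        _ = _ := by ring
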